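/- Let $T=(V,E)$ be a tree with $n\ge 2$ vertices and maximum degree at most $k$, and let $L=\{l_1,\dots,l_n\}$ be a set of labels. The true labeling is a bijection $M_T:L\to V$, the hypothesized labeling is an arbitrary map $M_H:L\to V$, and $D(\mathcal T,\mathcal H)=\sum_{l\in L} d_T(M_T(l),M_H(l))$, where $d_T$ is the tree distance. Both labelings start from arbitrary configurations and evolve as follows. In every time unit the tracking algorithm makes one step. It processes the labels cyclically in the order $l_1,\dots,l_n,l_1,\dots$; if $l$ is the current label and $M_H(l)\ne M_T(l)$, it moves $M_H(l)$ to the next vertex on the path in $T$ from $M_H(l)$ to $M_T(l)$; if $M_H(l)=M_T(l)$, it spends the step on noticing this, and the next label becomes the current one. One pass over all $n$ labels is an iteration; iterations are numbered $1,2,\dots$, and $D(\mathcal T,\mathcal H)_j$ denotes the value of $D(\mathcal T,\mathcal H)$ at the start of the $j$-th iteration. At the end of every second time unit (speedup factor $c=2$) the uniformly random evolver picks an edge of $T$ uniformly at random, independently of its earlier choices, and swaps the true locations of the two labels at the endpoints of this edge. Then for every $k$ there are constants $C,\gamma>0$ and a function $z(n)=O(\log n)$, all depending only on $k$, such that for every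 such $T$ with $n$ vertices, every pair of initial labelings, and every $j>z(n)$, $$\Pr\bigl[\,\text{the $j$-th iteration starts, and } D(\mathcal T,\mathcal H)_j\le C\,n\,\bigr]\ \ge\ 1-e^{-\gamma n}.$$ -/

import Mathlib

open MeasureTheory ProbabilityTheory Filter Asymptotics
open scoped ENNReal

namespace LabelTracking

variable {V : Type*} [DecidableEq V] {T : SimpleGraph V} {n : ℕ}

/-- The unique path from `u` to `w` in the tree `T`. -/
noncomputable def treePath (hT : T.IsTree) (u w : V) : T.Walk u w :=
  (hT.existsUnique_path u w).choose

/-- The oracle for the true labeling `M`: on the query `(l, u)` it answers `none` (null) if the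
label `l` resides at `u`, and otherwise the edge `(u, v)`, oriented away from `u`, with which the
path from `u` to the true location of `l` begins. -/
noncomputable def oracle (hT : T.IsTree) (M : Fin n ≃ V) (l : Fin n) (u : V) : Option T.Dart :=
  if h : u = M l then none
  else some ((treePath hT u (M l)).firstDart (SimpleGraph.Walk.not_nil_of_ne h))

/-- A configuration of the whole system: the true (bijective) labeling, the hypothesized (not
necessarily injective) labeling, and the number of labels that the algorithm has finished
processing so far, counted with repetition over all its iterations. -/
structure State (V : Type*) (n : ℕ) where
  truth : Fin n ≃ V
  hyp : Fin n → V
  finished : ℕ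

/-- The label which the algorithm is processing: the labels are processed cyclically in order. -/
def State.current [NeZero n] (s : State V n) : Fin n := Fin.ofNat n s.finished

/-- The number (starting from 1) of the current iteration, that is, of the current pass over all
the labels. -/
def State.iteration (s : State V n) : ℕ := s.finished / n + 1

/-- The overall distance: the sum over all labels of the tree distance between the true and the
hypothesized location. -/
noncomputable def State.distance (T : SimpleGraph V) (s : State V n) : ℕ :=
  ∑ l, T.dist (s.truth l) (s.hyp l)

/-- One step of the tracking algorithm: query the oracle on the current label and its hypothesized
location; on a null answer go on to the next label, otherwise move the label along the edge. -/
noncomputable def algorithmStep [NeZero n] (hT : T.IsTree) (s : State V n) : State V n :=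
  match oracle hT s.truth s.current (s.hyp s.current) with
  | none => { s with finished := s.finished + 1 }
  | some d => { s with hyp := Function.update s.hyp s.current d.snd }

/-- One step of the evolver: the labels at the two endpoints of the edge `e` are swapped. -/
def evolverStep (e : T.edgeSet) (s : State V n) : State V n :=
  { s with truth := s.truth.trans (Sym2.lift ⟨fun u v => Equiv.swap u v, Equiv.swap_comm⟩ e.1) }

/-- The state at time `t`, with initial labelings `M₀` and `H₀` and speedup factor `c`, if the
evolver chooses the edges `e 0, e 1, …`. The algorithm makes one step in every time unit, and the
evolver makes one swap at the end of every `c`-th time unit. -/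
noncomputable def run [NeZero n] (hT : T.IsTree) (c : ℕ) (M₀ : Fin n ≃ V) (H₀ : Fin n → V)
    (e : ℕ → T.edgeSet) : ℕ → State V n
  | 0 => ⟨M₀, H₀, 0⟩
  | t + 1 =>
    if c ∣ t + 1 then evolverStep (e (t / c)) (algorithmStep hT (run hT c M₀ H₀ e t))
    else algorithmStep hT (run hT c M₀ H₀ e t)

/-- In the trajectory `s`, iteration `j` starts at time `t`. -/
def StartsIteration (s : ℕ → State V n) (j t : ℕ) : Prop :=
  IsLeast {t' | (s t').iteration = j} t

/-- A uniformly random evolver: the chosen edges `E 0, E 1, …` are independent random variables,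
each of them uniformly distributed on the edges of the tree `T`. -/
structure IsUniformEvolver {Ω : Type*} [MeasurableSpace Ω] (μ : Measure Ω)
    (E : ℕ → Ω → T.edgeSet) : Prop where
  measurable : ∀ i e, MeasurableSet {ω | E i ω = e}
  indep : iIndepFun (m := fun _ => ⊤) E μ
  uniform : ∀ i e, μ {ω | E i ω = e} = (Nat.card T.edgeSet : ℝ≥0∞)⁻¹

end LabelTracking

/-! Write `D` for the overall distance. A swap moves two labels by one edge each, so it raises `D`
by at most 2; its `gain` is the nonnegative shortfall from 2. The algorithm makes two steps per
swap, each lowering `D` by 1 except for the `n` null answers of an iteration. Hence `D` falls over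
an iteration by the total gain, up to `O(n)` (`distance_run_le`). Conversely, a label has distance 0
when it is finished and is displaced afterwards only by swaps, so `D` at the end of an iteration is
at most about twice the number of its swaps (`distance_le_two_mul`). It remains to show that the
gain is proportional to the number of swaps: then one iteration shrinks `D` by a constant factor up
to `O(n)` (`distance_contraction`), and `O(log n)` iterations bring any `D ≤ n²` down to `O(n)`.

Gain comes from cancellation. If an edge is swapped twice, with no edge meeting it swapped in
between and with the hypotheses of the labels at its ends unchanged, then the two swaps undo each
other and gain 4 together (`gain_add_gain_eq_four`). The algorithm can spoil at most one such pair
for each label that it touches, since the pairs found in one window use disjoint edges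
(`four_mul_card_hits_le`). In a window of `Θ(n)` random choices, the first phase leaves linearly
many chosen edges live, and the second phase hits linearly many of them. Exponential moments bound
the failure probability by `exp(-Ω(n))` (`measure_window_le`).

To reach iteration `j`, restart from the trivial bound `n²` at iteration `j - z`. Its starting time
is random but determined by earlier swaps, hence independent of later windows. A union bound over
polynomially many windows then suffices (`measure_exists_not_goodWindow_le`). -/

namespace LabelTracking

open scoped NNReal

/-! ### Functions of disjoint sets of independent choices -/

section Independence

variable {𝓔 Ω : Type*} [Finite 𝓔] [MeasurableSpace 𝓔] [DiscreteMeasurableSpace 𝓔]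
  [MeasurableSpace Ω] {μ : Measure Ω} {E : ℕ → Ω → 𝓔}

lemma measurable_comp_of_dependsOn {β : Type*} [MeasurableSpace β] [Nonempty β]
    (hm : ∀ i, Measurable (E i)) {G : (ℕ → 𝓔) → β} {S : Finset ℕ} (hG : DependsOn G S) :
    Measurable fun ω => G fun i => E i ω := by
  obtain ⟨g, rfl⟩ := dependsOn_iff_exists_comp.1 hG
  exact (Measurable.of_discrete (f := g)).comp (measurable_pi_lambda _ fun i => hm i)

lemma indepFun_comp_of_dependsOn {β γ : Type*} [MeasurableSpace β] [MeasurableSpace γ]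
    [Nonempty β] [Nonempty γ] (hind : iIndepFun E μ) (hm : ∀ i, Measurable (E i))
    {G : (ℕ → 𝓔) → β} {G' : (ℕ → 𝓔) → γ} {S S' : Finset ℕ} (hS : Disjoint S S')
    (hG : DependsOn G S) (hG' : DependsOn G' S') :
    IndepFun (fun ω => G fun i => E i ω) (fun ω => G' fun i => E i ω) μ := by
  obtain ⟨g, rfl⟩ := dependsOn_iff_exists_comp.1 hG
  obtain ⟨g', rfl⟩ := dependsOn_iff_exists_comp.1 hG'
  exact (hind.indepFun_finset S S' hS hm).comp
    (Measurable.of_discrete (f := g)) (Measurable.of_discrete (f := g'))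

end Independence

/-! ### Multiplicative drift of expectations -/

section Supermartingale

variable {𝓔 Ω : Type*} [Fintype 𝓔] [DecidableEq 𝓔] [MeasurableSpace 𝓔]
  [DiscreteMeasurableSpace 𝓔] [MeasurableSpace Ω] {μ : Measure Ω} {E : ℕ → Ω → 𝓔}

/-- If resampling the `i`-th coordinate uniformly increases `Z` to at most `q * Z` on average, then
the expectation grows at most by the factor `q`. -/
lemma lintegral_succ_le (hind : iIndepFun E μ) (hm : ∀ i, Measurable (E i))
    (hu : ∀ i e, μ {ω | E i ω = e} = (Fintype.card 𝓔 : ℝ≥0∞)⁻¹)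
    {Z Z' : (ℕ → 𝓔) → ℝ≥0} {i : ℕ} {q : ℝ≥0} (hZ' : DependsOn Z' (Finset.range (i + 1)))
    (hq : ∀ f, ∑ e, Z' (Function.update f i e) ≤ q * Fintype.card 𝓔 * Z f) :
    ∫⁻ ω, Z' (fun x => E x ω) ∂μ ≤ q * ∫⁻ ω, Z (fun x => E x ω) ∂μ := by
  rcases isEmpty_or_nonempty 𝓔 with h𝓔 | h𝓔
  · have : IsEmpty Ω := ⟨fun ω => h𝓔.false (E 0 ω)⟩
    simp [Subsingleton.elim μ 0]
  -- Resampling overwrites coordinate `i`, so what remains is determined by the earlier coordinates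
  -- and is independent of `E i`.
  have hdep : ∀ e, DependsOn (fun f => (Z' (Function.update f i e) : ℝ≥0∞)) (Finset.range i) := by
    intro e f g hfg
    simp only [ENNReal.coe_inj]
    refine hZ' fun x hx => ?_
    by_cases hxi : x = i
    · subst hxi; simp
    · have : x < i := by simp at hx; omega
      simp [hxi, hfg x (by simpa using this)]
  have hind' : ∀ e, ∫⁻ ω, (Z' (Function.update (fun x => E x ω) i e) : ℝ≥0∞) *
        (if E i ω = e then 1 else 0) ∂μ
      = (∫⁻ ω, (Z' (Function.update (fun x => E x ω) i e) : ℝ≥0∞) ∂μ) *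
        (Fintype.card 𝓔 : ℝ≥0∞)⁻¹ := by
    intro e
    have hdi : DependsOn (fun f : ℕ → 𝓔 => if f i = e then (1 : ℝ≥0∞) else 0)
        (({i} : Finset ℕ) : Set ℕ) := by
      intro f g hfg
      simp [hfg i (by simp)]
    have h1 := lintegral_mul_eq_lintegral_mul_lintegral_of_indepFun
      (measurable_comp_of_dependsOn hm (hdep e)) (measurable_comp_of_dependsOn hm hdi)
      (indepFun_comp_of_dependsOn hind hm (by simp) (hdep e) hdi)
    simp only [Pi.mul_apply] at h1
    rw [h1]
    congr 1
    have hms : MeasurableSet {ω | E i ω = e} := hm i (MeasurableSet.of_discrete (s := {e}))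
    rw [← hu i e, ← lintegral_indicator_one hms]
    exact lintegral_congr fun ω => by simp [Set.indicator_apply]
  have hcard : (Fintype.card 𝓔 : ℝ≥0∞) ≠ 0 := by simp
  calc ∫⁻ ω, Z' (fun x => E x ω) ∂μ
      = ∫⁻ ω, ∑ e, (Z' (Function.update (fun x => E x ω) i e) : ℝ≥0∞) *
          (if E i ω = e then 1 else 0) ∂μ := by
        refine lintegral_congr fun ω => ?_
        simp only [mul_ite, mul_one, mul_zero, Finset.sum_ite_eq, Finset.mem_univ, if_true]
        congr 2
        exact (Function.update_eq_self i (fun x => E x ω)).symm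
    _ = ∑ e, (∫⁻ ω, (Z' (Function.update (fun x => E x ω) i e) : ℝ≥0∞) ∂μ) *
          (Fintype.card 𝓔 : ℝ≥0∞)⁻¹ := by
        rw [lintegral_finsetSum]
        · simp_rw [hind']
        · intro e _
          refine (measurable_comp_of_dependsOn hm (hdep e)).mul ?_
          exact Measurable.ite (hm i (MeasurableSet.of_discrete (s := {e}))) measurable_const
            measurable_const
    _ = (∫⁻ ω, ((∑ e, Z' (Function.update (fun x => E x ω) i e) : ℝ≥0) : ℝ≥0∞) ∂μ) *
          (Fintype.card 𝓔 : ℝ≥0∞)⁻¹ := by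
        rw [← Finset.sum_mul]
        push_cast
        rw [lintegral_finsetSum]
        exact fun e _ => measurable_comp_of_dependsOn hm (hdep e)
    _ ≤ (∫⁻ ω, ((q * Fintype.card 𝓔 * Z (fun x => E x ω) : ℝ≥0) : ℝ≥0∞) ∂μ) *
          (Fintype.card 𝓔 : ℝ≥0∞)⁻¹ := by
        gcongr
        exact hq _
    _ = q * ∫⁻ ω, Z (fun x => E x ω) ∂μ := by
        push_cast
        rw [lintegral_const_mul' _ _ (by finiteness), mul_right_comm, mul_assoc (q : ℝ≥0∞),
          ENNReal.mul_inv_cancel hcard (by finiteness), mul_one]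

/-- The offset `a` lets the process start after a first phase: it is 0 for clashes and the length of
that phase for hits. -/
lemma lintegral_add_le_pow (hind : iIndepFun E μ) (hm : ∀ i, Measurable (E i))
    (hu : ∀ i e, μ {ω | E i ω = e} = (Fintype.card 𝓔 : ℝ≥0∞)⁻¹)
    {Z : ℕ → (ℕ → 𝓔) → ℝ≥0} {a b : ℕ} {q : ℝ≥0}
    (hZ : ∀ i, DependsOn (Z i) (Finset.range (a + i)))
    (hq : ∀ i < b, ∀ f, ∑ e, Z (i + 1) (Function.update f (a + i) e) ≤
      q * Fintype.card 𝓔 * Z i f) :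
    ∫⁻ ω, Z b (fun x => E x ω) ∂μ ≤ q ^ b * ∫⁻ ω, Z 0 (fun x => E x ω) ∂μ := by
  induction b with
  | zero => simp
  | succ b ih =>
    calc _ ≤ q * ∫⁻ ω, Z b (fun x => E x ω) ∂μ :=
          lintegral_succ_le hind hm hu (hZ (b + 1)) (hq b (by omega))
      _ ≤ q * (q ^ b * ∫⁻ ω, Z 0 (fun x => E x ω) ∂μ) := by
          gcongr
          exact ih fun i hi => hq i (by omega)
      _ = _ := by ring

end Supermartingale

/-! ### Combinatorics of live elements, clashes and hits -/

section Live

variable {𝓔 : Type*} [DecidableEq 𝓔] (R : 𝓔 → 𝓔 → Prop) [DecidableRel R]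

/-- The elements chosen among the first `m` terms of `f` such that no later term with index less
than `i` is related to them. -/
def live (m : ℕ) (f : ℕ → 𝓔) : ℕ → Finset 𝓔
  | 0 => ∅
  | i + 1 =>
    if i < m then insert (f i) ((live m f i).filter fun e => ¬ R e (f i))
    else (live m f i).filter fun e => ¬ R e (f i)

/-- The number of terms of `f` with index less than `i` which are related to a live element. -/
def clashes (m : ℕ) (f : ℕ → 𝓔) (i : ℕ) : ℕ :=
  ∑ x ∈ Finset.range i, if ∃ e ∈ live R m f x, R e (f x) then 1 else 0

/-- The indices in `[m, m + j)` at which `f` chooses a live element. -/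
def hits (m : ℕ) (f : ℕ → 𝓔) (j : ℕ) : Finset ℕ :=
  (Finset.Ico m (m + j)).filter fun x => f x ∈ live R m f x

variable {R} {m : ℕ}

lemma live_congr {f g : ℕ → 𝓔} {i : ℕ} (h : ∀ x < i, f x = g x) :
    live R m f i = live R m g i := by
  induction i with
  | zero => rfl
  | succ i ih =>
    simp only [live, ih fun x hx => h x (by omega), h i (by omega)]

lemma clashes_congr {f g : ℕ → 𝓔} {i : ℕ} (h : ∀ x < i, f x = g x) :
    clashes R m f i = clashes R m g i := by
  refine Finset.sum_congr rfl fun x hx => ?_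
  rw [Finset.mem_range] at hx
  rw [live_congr fun y hy => h y (hy.trans hx), h x hx]

lemma hits_congr {f g : ℕ → 𝓔} {j : ℕ} (h : ∀ x < m + j, f x = g x) :
    hits R m f j = hits R m g j := by
  refine Finset.filter_congr fun x hx => ?_
  rw [Finset.mem_Ico] at hx
  rw [live_congr fun y hy => h y (hy.trans hx.2), h x hx.2]

lemma exists_of_mem_live {f : ℕ → 𝓔} {i : ℕ} {e : 𝓔} (he : e ∈ live R m f i) :
    ∃ x < m, x < i ∧ f x = e ∧ ∀ y, x < y → y < i → ¬ R e (f y) := by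
  induction i with
  | zero => simp [live] at he
  | succ i ih =>
    have key : e ∈ (live R m f i).filter (fun e => ¬ R e (f i)) →
        ∃ x < m, x < i + 1 ∧ f x = e ∧ ∀ y, x < y → y < i + 1 → ¬ R e (f y) := by
      intro h
      rw [Finset.mem_filter] at h
      obtain ⟨x, hxm, hxi, hx, hy⟩ := ih h.1
      refine ⟨x, hxm, by omega, hx, fun y hxy hyi => ?_⟩
      rcases Nat.lt_succ_iff_lt_or_eq.1 hyi with h' | rfl
      exacts [hy y hxy h', h.2]
    rw [live] at he
    split_ifs at he with him
    · rcases Finset.mem_insert.1 he with rfl | h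
      · exact ⟨i, him, by omega, rfl, fun y h1 h2 => by omega⟩
      · exact key h
    · exact key he

lemma card_live_le (f : ℕ → 𝓔) (i : ℕ) : (live R m f i).card ≤ m := by
  suffices h : (live R m f i).card ≤ min i m from h.trans (min_le_right _ _)
  induction i with
  | zero => simp [live]
  | succ i ih =>
    have h1 := Finset.card_filter_le (live R m f i) fun e => ¬ R e (f i)
    rw [live]
    split_ifs with him
    · have h2 := Finset.card_insert_le (f i) ((live R m f i).filter fun e => ¬ R e (f i))
      omega
    · omega

variable [Fintype 𝓔] {κ : ℕ}

lemma card_live_le_card_filter_add (hdeg : ∀ x, (Finset.univ.filter fun e => R e x).card ≤ κ)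
    (f : ℕ → 𝓔) (i : ℕ) (x : 𝓔) :
    (live R m f i).card ≤ ((live R m f i).filter fun e => ¬ R e x).card + κ := by
  rw [← Finset.card_filter_add_card_filter_not (s := live R m f i) (fun e => R e x), add_comm]
  gcongr
  exact (Finset.card_le_card (Finset.filter_subset_filter _ (Finset.subset_univ _))).trans (hdeg x)

/-- A choice without a clash adds a new live element, new because reflexivity would make a
repetition a clash. A choice with a clash removes at most `κ` elements. -/
lemma le_card_live_add (hrefl : ∀ e, R e e)
    (hdeg : ∀ x, (Finset.univ.filter fun e => R e x).card ≤ κ)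
    (f : ℕ → 𝓔) {i : ℕ} (hi : i ≤ m) :
    i ≤ (live R m f i).card + κ * clashes R m f i := by
  induction i with
  | zero => simp
  | succ i ih =>
    have ih := ih (by omega)
    rw [live, if_pos (by omega), Finset.card_insert_of_notMem (by simp [hrefl]), clashes,
      Finset.sum_range_succ, ← clashes]
    split_ifs with h
    · have := card_live_le_card_filter_add (m := m) hdeg f i (f i)
      rw [mul_add]
      omega
    · push Not at h
      rw [Finset.filter_true_of_mem h, add_zero]
      omega

lemma card_live_le_card_live_add
    (hdeg : ∀ x, (Finset.univ.filter fun e => R e x).card ≤ κ) (f : ℕ → 𝓔) (j : ℕ) :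
    (live R m f m).card ≤ (live R m f (m + j)).card + κ * j := by
  induction j with
  | zero => simp
  | succ j ih =>
    have := card_live_le_card_filter_add (m := m) hdeg f (m + j) (f (m + j))
    rw [← add_assoc, live, if_neg (by omega), mul_add]
    omega

lemma card_filter_clash_le (hdeg : ∀ x, (Finset.univ.filter fun e => R x e).card ≤ κ)
    (f : ℕ → 𝓔) (i : ℕ) :
    (Finset.univ.filter fun x => ∃ e ∈ live R m f i, R e x).card ≤ m * κ := by
  calc _ ≤ ((live R m f i).biUnion fun e => Finset.univ.filter fun x => R e x).card := by
        refine Finset.card_le_card fun x hx => ?_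
        simpa using hx
    _ ≤ (live R m f i).card * κ := Finset.card_biUnion_le_card_mul _ _ _ fun e _ => hdeg e
    _ ≤ m * κ := by gcongr; exact card_live_le f i

end Live

/-! ### Exponential tail bounds for the two phases of a window -/

section Chernoff

variable {𝓔 Ω : Type*} [Fintype 𝓔] [DecidableEq 𝓔] [MeasurableSpace 𝓔]
  [DiscreteMeasurableSpace 𝓔] [MeasurableSpace Ω] {μ : Measure Ω} [IsProbabilityMeasure μ]
  {E : ℕ → Ω → 𝓔} {R : 𝓔 → 𝓔 → Prop} [DecidableRel R] {κ m : ℕ}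

/-- Whatever the past, a choice clashes with probability at most `m * κ / card 𝓔 ≤ 1 / (120 * κ)`.
So the mean of `16 ^ clashes` grows per step by at most the factor `1 + 15 / (120 * κ)`, hence in
total by at most `exp r`, and Markov's inequality applies. -/
lemma measure_le_clashes (hind : iIndepFun E μ) (hm : ∀ i, Measurable (E i))
    (hu : ∀ i e, μ {ω | E i ω = e} = (Fintype.card 𝓔 : ℝ≥0∞)⁻¹)
    (hdeg : ∀ x, (Finset.univ.filter fun e => R x e).card ≤ κ) (hκ : 0 < κ) {r : ℕ}
    (hr : 960 * κ ^ 3 * r ≤ Fintype.card 𝓔) :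
    μ {ω | r ≤ clashes R (8 * κ * r) (fun i => E i ω) (8 * κ * r)} ≤
      ENNReal.ofReal (Real.exp (-r)) := by
  set m := 8 * κ * r with hmdef
  set Z : ℕ → (ℕ → 𝓔) → ℝ≥0 := fun i f => 16 ^ clashes R m f i with hZdef
  have hZ : ∀ i, DependsOn (Z i) (Finset.range (0 + i)) := by
    intro i f g h
    simp only [hZdef]
    rw [clashes_congr fun x hx => h x (by simpa using hx)]
  set q : ℝ≥0 := 1 + 1 / (8 * κ) with hqdef
  have hκ0 : (κ : ℝ≥0) ≠ 0 := by exact_mod_cast hκ.ne'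
  have hstep : ∀ i < m, ∀ f, ∑ e, Z (i + 1) (Function.update f (0 + i) e) ≤
      q * Fintype.card 𝓔 * Z i f := by
    intro i _ f
    have h1 : ∀ e, Z (i + 1) (Function.update f (0 + i) e) =
        Z i f * (1 + 15 * if ∃ e' ∈ live R m f i, R e' e then 1 else 0) := by
      intro e
      have hag : ∀ x < i, Function.update f (0 + i) e x = f x := fun x hx => by
        rw [Function.update_of_ne (by omega)]
      simp only [hZdef]
      rw [clashes, Finset.sum_range_succ, ← clashes, clashes_congr hag, live_congr hag, pow_add]
      simp only [zero_add, Function.update_self]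
      congr 1
      split_ifs <;> norm_num
    simp_rw [h1]
    rw [← Finset.mul_sum, Finset.sum_add_distrib, ← Finset.mul_sum, Finset.sum_boole, mul_comm]
    gcongr
    have h2 := card_filter_clash_le (m := m) hdeg f i
    have h3 : 15 * (Finset.univ.filter fun x => ∃ e ∈ live R m f i, R e x).card * (8 * κ) ≤
        Fintype.card 𝓔 := by
      refine le_trans ?_ hr
      calc _ ≤ 15 * (m * κ) * (8 * κ) := by gcongr
        _ = _ := by rw [hmdef]; ring
    have h4 : (15 * (Finset.univ.filter fun x => ∃ e ∈ live R m f i, R e x).card : ℝ≥0) ≤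
        1 / (8 * κ) * Fintype.card 𝓔 := by
      rw [one_div, ← div_eq_inv_mul, le_div_iff₀ (by positivity)]
      exact_mod_cast h3
    simp only [Finset.sum_const, Finset.card_univ, nsmul_eq_mul, mul_one]
    rw [hqdef, add_mul, one_mul]
    gcongr
  have hint := lintegral_add_le_pow hind hm hu hZ hstep
  have hq : (q : ℝ) ^ m ≤ Real.exp r := by
    have : (q : ℝ) ≤ Real.exp (1 / (8 * κ)) := by
      rw [hqdef]
      push_cast
      linarith [Real.add_one_le_exp (1 / (8 * κ : ℝ))]
    calc (q : ℝ) ^ m ≤ Real.exp (1 / (8 * κ)) ^ m := by gcongr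
      _ = Real.exp r := by
        rw [← Real.exp_nat_mul, hmdef]
        push_cast
        congr 1
        have : (κ : ℝ) ≠ 0 := by exact_mod_cast hκ.ne'
        field_simp
  have h0 : ∫⁻ ω, Z 0 (fun x => E x ω) ∂μ = 1 := by simp [hZdef, clashes]
  rw [h0, mul_one] at hint
  have hmark := mul_meas_ge_le_lintegral (μ := μ)
    (f := fun ω => (Z m (fun x => E x ω) : ℝ≥0∞))
    (measurable_comp_of_dependsOn hm (hZ m)).coe_nnreal_ennreal (16 ^ r : ℝ≥0)
  have hsub : {ω | r ≤ clashes R m (fun i => E i ω) m} ⊆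
      {ω | ((16 ^ r : ℝ≥0) : ℝ≥0∞) ≤ Z m (fun x => E x ω)} := by
    intro ω hω
    simp only [Set.mem_ofPred_eq, ENNReal.coe_le_coe, hZdef] at hω ⊢
    exact pow_le_pow_right₀ (by norm_num) hω
  have h16 : ((16 ^ r : ℝ≥0) : ℝ≥0∞) * μ {ω | r ≤ clashes R m (fun i => E i ω) m} ≤
      ENNReal.ofReal (Real.exp r) := by
    calc _ ≤ _ := mul_le_mul_right (measure_mono hsub) _
      _ ≤ _ := hmark.trans hint
      _ ≤ _ := by
        rw [← ENNReal.coe_pow, ← ENNReal.ofReal_coe_nnreal]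
        exact ENNReal.ofReal_le_ofReal (by simpa using hq)
  rw [mul_comm, ← ENNReal.le_div_iff_mul_le (by simp) (by simp)] at h16
  refine h16.trans ?_
  rw [← ENNReal.ofReal_coe_nnreal, ← ENNReal.ofReal_div_of_pos (by positivity)]
  refine ENNReal.ofReal_le_ofReal ?_
  rw [div_le_iff₀ (by positivity), Real.exp_neg, ← div_eq_inv_mul, le_div_iff₀ (Real.exp_pos _)]
  push_cast
  have he : Real.exp 1 * Real.exp 1 ≤ 16 := by
    have := Real.exp_one_lt_d9
    nlinarith [Real.exp_pos 1]
  calc Real.exp r * Real.exp r = (Real.exp 1 * Real.exp 1) ^ r := by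
        rw [mul_pow, ← Real.exp_nat_mul, mul_one]
    _ ≤ 16 ^ r := by gcongr

/-- Each of the `2 * r` choices removes at most `κ` live elements, so at least `r` of the initial `7
* κ * r` persist and every choice is a hit with probability at least `1 / (2 * K)`. Markov's
inequality is applied to `(1 / 2) ^ hits`. -/
lemma measure_card_hits_lt (hind : iIndepFun E μ) (hm : ∀ i, Measurable (E i))
    (hu : ∀ i e, μ {ω | E i ω = e} = (Fintype.card 𝓔 : ℝ≥0∞)⁻¹)
    (hdeg : ∀ x, (Finset.univ.filter fun e => R e x).card ≤ κ) (hκ : 0 < κ) {r K ρ : ℕ}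
    (hK : 0 < K) (hrK : r = 8 * K * ρ) (hr : Fintype.card 𝓔 ≤ 2 * K * r) :
    μ {ω | 7 * κ * r ≤ (live R m (fun i => E i ω) m).card ∧
        (hits R m (fun i => E i ω) (2 * r)).card < 2 * ρ} ≤
      ENNReal.ofReal (Real.exp (-ρ)) := by
  -- The value 0 when too few elements are live makes the drift bound hold for every past without
  -- conditioning.
  set Z : ℕ → (ℕ → 𝓔) → ℝ≥0 := fun j f =>
    if 7 * κ * r ≤ (live R m f m).card then (1 / 2) ^ (hits R m f j).card else 0 with hZdef
  have hZ : ∀ i, DependsOn (Z i) (Finset.range (m + i)) := by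
    intro i f g h
    simp only [hZdef]
    rw [hits_congr fun x hx => h x (by simpa using hx),
      live_congr fun x hx => h x (by simp; omega)]
  have hKR : (0 : ℝ) < K := by exact_mod_cast hK
  have hK1 : (1 : ℝ) ≤ K := by exact_mod_cast hK
  set q : ℝ≥0 := ⟨1 - 1 / (4 * K), by
    rw [sub_nonneg, div_le_one (by positivity)]; linarith⟩ with hqdef
  have hqR : (q : ℝ) = 1 - 1 / (4 * K) := rfl
  have hstep : ∀ i < 2 * r, ∀ f, ∑ e, Z (i + 1) (Function.update f (m + i) e) ≤
      q * Fintype.card 𝓔 * Z i f := by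
    intro i hi f
    have hag : ∀ e, ∀ x < m + i, Function.update f (m + i) e x = f x := fun e x hx => by
      rw [Function.update_of_ne (by omega)]
    by_cases hc : 7 * κ * r ≤ (live R m f m).card
    · have h1 : ∀ e, (Z (i + 1) (Function.update f (m + i) e) : ℝ) =
          Z i f * (1 - 1 / 2 * if e ∈ live R m f (m + i) then 1 else 0) := by
        intro e
        have hl : live R m (Function.update f (m + i) e) m = live R m f m :=
          live_congr fun x hx => hag e x (by omega)
        have hh : hits R m (Function.update f (m + i) e) (i + 1) =
            if e ∈ live R m f (m + i) then insert (m + i) (hits R m f i) else hits R m f i := by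
          have hIco : Finset.Ico m (m + (i + 1)) = insert (m + i) (Finset.Ico m (m + i)) := by
            ext x; simp; omega
          rw [← hits_congr (hag e), hits, hIco, Finset.filter_insert, ← hits,
            live_congr (hag e), Function.update_self]
        simp only [hZdef]
        rw [hl, if_pos hc, if_pos hc, hh]
        split_ifs
        · rw [Finset.card_insert_of_notMem (by simp [hits]), pow_succ]
          push_cast
          ring
        · push_cast
          ring
      have hlive : r ≤ (live R m f (m + i)).card := by
        have h2 := card_live_le_card_live_add (m := m) hdeg f i
        have h3 : κ * i ≤ κ * (2 * r) := by gcongr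
        have h4 : r ≤ κ * r := Nat.le_mul_of_pos_left r hκ
        nlinarith
      rw [← NNReal.coe_le_coe]
      push_cast
      simp_rw [h1]
      rw [← Finset.mul_sum, Finset.sum_sub_distrib, ← Finset.mul_sum, Finset.sum_boole, mul_comm]
      gcongr
      simp only [Finset.sum_const, Finset.card_univ, nsmul_eq_mul, mul_one,
        Finset.filter_univ_mem]
      rw [hqR]
      have h5 : (Fintype.card 𝓔 : ℝ) ≤ 2 * K * r := by exact_mod_cast hr
      have h6 : (r : ℝ) ≤ (live R m f (m + i)).card := by exact_mod_cast hlive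
      have h7 : 1 / (4 * K) * (Fintype.card 𝓔 : ℝ) ≤ r / 2 := by
        rw [one_div, ← div_eq_inv_mul, div_le_iff₀ (by positivity)]
        linarith
      linarith
    · have h1 : ∀ e, Z (i + 1) (Function.update f (m + i) e) = 0 := by
        intro e
        have hl : live R m (Function.update f (m + i) e) m = live R m f m :=
          live_congr fun x hx => hag e x (by omega)
        simp only [hZdef]
        rw [hl, if_neg hc]
      simp [h1]
  have hint := lintegral_add_le_pow hind hm hu hZ hstep
  have hq : (q : ℝ) ^ (2 * r) ≤ Real.exp (-(4 * ρ)) := by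
    have : (q : ℝ) ≤ Real.exp (-(1 / (4 * K))) := by
      rw [hqR]
      linarith [Real.add_one_le_exp (-(1 / (4 * K : ℝ)))]
    calc (q : ℝ) ^ (2 * r) ≤ Real.exp (-(1 / (4 * K))) ^ (2 * r) := by gcongr
      _ = Real.exp (-(4 * ρ)) := by
        rw [← Real.exp_nat_mul, hrK]
        push_cast
        congr 1
        field_simp
        ring
  have h0 : ∫⁻ ω, Z 0 (fun x => E x ω) ∂μ ≤ 1 := by
    calc _ ≤ ∫⁻ ω, 1 ∂μ := by
          refine lintegral_mono fun ω => ?_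
          simp only [hZdef]
          split_ifs <;> simp [hits]
      _ = 1 := by simp
  have hmark := mul_meas_ge_le_lintegral (μ := μ)
    (f := fun ω => (Z (2 * r) (fun x => E x ω) : ℝ≥0∞))
    (measurable_comp_of_dependsOn hm (hZ (2 * r))).coe_nnreal_ennreal ((1 / 2) ^ (2 * ρ) : ℝ≥0)
  set B := {ω | 7 * κ * r ≤ (live R m (fun i => E i ω) m).card ∧
        (hits R m (fun i => E i ω) (2 * r)).card < 2 * ρ}
  have hsub : B ⊆ {ω | (((1 / 2) ^ (2 * ρ) : ℝ≥0) : ℝ≥0∞) ≤ Z (2 * r) (fun x => E x ω)} := by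
    rintro ω ⟨h1, h2⟩
    simp only [Set.mem_ofPred_eq, ENNReal.coe_le_coe, hZdef]
    rw [if_pos h1]
    exact pow_le_pow_of_le_one (by positivity) (by rw [← NNReal.coe_le_coe]; norm_num) h2.le
  have h16 : (((1 / 2) ^ (2 * ρ) : ℝ≥0) : ℝ≥0∞) * μ B ≤ ENNReal.ofReal (Real.exp (-(4 * ρ))) := by
    calc _ ≤ _ := mul_le_mul_right (measure_mono hsub) _
      _ ≤ _ := hmark.trans hint
      _ ≤ (q : ℝ≥0∞) ^ (2 * r) * 1 := by gcongr
      _ ≤ _ := by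
        rw [mul_one, ← ENNReal.coe_pow, ← ENNReal.ofReal_coe_nnreal]
        exact ENNReal.ofReal_le_ofReal (by simpa using hq)
  rw [mul_comm, ← ENNReal.le_div_iff_mul_le (by simp) (by simp)] at h16
  refine h16.trans ?_
  rw [← ENNReal.ofReal_coe_nnreal, ← ENNReal.ofReal_div_of_pos (by positivity)]
  refine ENNReal.ofReal_le_ofReal ?_
  rw [div_le_iff₀ (by positivity)]
  push_cast
  have he : Real.exp (-1) ≤ 1 / 2 := by
    rw [Real.exp_neg, inv_le_comm₀ (Real.exp_pos _) (by norm_num)]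
    have := Real.exp_one_gt_d9
    norm_num
    linarith
  calc Real.exp (-(4 * ρ)) ≤ Real.exp (-ρ) * Real.exp (-1) ^ (2 * ρ) := by
        rw [← Real.exp_nat_mul, ← Real.exp_add]
        refine Real.exp_le_exp.2 ?_
        push_cast
        have : (0 : ℝ) ≤ ρ := by positivity
        linarith
    _ ≤ Real.exp (-ρ) * (1 / 2) ^ (2 * ρ) := by gcongr

/-- A window of `8 * κ * r + 2 * r` uniform choices has fewer than `2 * ρ` hits only with
exponentially small probability. -/
theorem measure_window_le (hind : iIndepFun E μ) (hm : ∀ i, Measurable (E i))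
    (hu : ∀ i e, μ {ω | E i ω = e} = (Fintype.card 𝓔 : ℝ≥0∞)⁻¹) (hrefl : ∀ e, R e e)
    (hsymm : ∀ x y, R x y → R y x)
    (hdeg : ∀ x, (Finset.univ.filter fun e => R x e).card ≤ κ) (hκ : 0 < κ) {r K ρ : ℕ}
    (hK : 0 < K) (hrK : r = 8 * K * ρ) (hr : Fintype.card 𝓔 ≤ 2 * K * r)
    (hr' : 960 * κ ^ 3 * r ≤ Fintype.card 𝓔) :
    μ {ω | (hits R (8 * κ * r) (fun i => E i ω) (2 * r)).card < 2 * ρ} ≤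
      ENNReal.ofReal (2 * Real.exp (-ρ)) := by
  have hdeg' : ∀ x, (Finset.univ.filter fun e => R e x).card ≤ κ := by
    intro x
    refine le_trans (Finset.card_le_card fun e he => ?_) (hdeg x)
    simp only [Finset.mem_filter, Finset.mem_univ, true_and] at he ⊢
    exact hsymm _ _ he
  have h1 := measure_le_clashes hind hm hu hdeg hκ hr'
  have h2 := measure_card_hits_lt (m := 8 * κ * r) hind hm hu hdeg' hκ hK hrK hr
  have hexp : Real.exp (-r) ≤ Real.exp (-ρ) := by
    refine Real.exp_le_exp.2 (neg_le_neg ?_)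
    have : ρ ≤ r := hrK ▸ Nat.le_mul_of_pos_left ρ (by omega)
    exact_mod_cast this
  have hsub : {ω | (hits R (8 * κ * r) (fun i => E i ω) (2 * r)).card < 2 * ρ} ⊆
      {ω | r ≤ clashes R (8 * κ * r) (fun i => E i ω) (8 * κ * r)} ∪
      {ω | 7 * κ * r ≤ (live R (8 * κ * r) (fun i => E i ω) (8 * κ * r)).card ∧
        (hits R (8 * κ * r) (fun i => E i ω) (2 * r)).card < 2 * ρ} := by
    intro ω hω
    by_cases hc : r ≤ clashes R (8 * κ * r) (fun i => E i ω) (8 * κ * r)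
    · exact Or.inl hc
    · refine Or.inr ⟨?_, hω⟩
      have h3 := le_card_live_add hrefl hdeg' (fun i => E i ω) (le_refl (8 * κ * r))
      have h4 : κ * clashes R (8 * κ * r) (fun i => E i ω) (8 * κ * r) ≤ κ * r := by
        gcongr
        omega
      nlinarith
  calc _ ≤ _ := measure_mono hsub
    _ ≤ _ := measure_union_le _ _
    _ ≤ ENNReal.ofReal (Real.exp (-ρ)) + ENNReal.ofReal (Real.exp (-ρ)) :=
        add_le_add (h1.trans (ENNReal.ofReal_le_ofReal hexp)) h2
    _ = _ := by rw [← ENNReal.ofReal_add (by positivity) (by positivity), two_mul]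

end Chernoff

/-! ### Effect of single algorithm and evolver steps -/

section Steps

variable {V : Type*} {T : SimpleGraph V} {n : ℕ}

lemma length_treePath (hT : T.IsTree) (u w : V) : (treePath hT u w).length = T.dist u w := by
  obtain ⟨p, hp, hlen⟩ := hT.connected.exists_path_of_dist u w
  have hq : (treePath hT u w).IsPath := (hT.existsUnique_path u w).choose_spec.1
  rw [← hlen, (hT.existsUnique_path u w).unique hp hq]

lemma dist_firstDart_snd (hT : T.IsTree) {u w : V} (h : u ≠ w) :
    T.dist w ((treePath hT u w).firstDart (SimpleGraph.Walk.not_nil_of_ne h)).snd + 1 =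
      T.dist w u := by
  have hlen := length_treePath hT u w
  have hnil : ¬ (treePath hT u w).Nil := SimpleGraph.Walk.not_nil_of_ne h
  have hadj := (treePath hT u w).adj_snd hnil
  have h1 : T.dist (treePath hT u w).snd w ≤ (treePath hT u w).tail.length :=
    SimpleGraph.dist_le _
  have h2 := SimpleGraph.Walk.length_tail_add_one hnil
  have h3 := hT.connected.dist_triangle (u := u) (v := (treePath hT u w).snd) (w := w)
  rw [SimpleGraph.dist_eq_one_iff_adj.2 hadj] at h3
  rw [T.dist_comm (u := w) (v := u), T.dist_comm (u := w)]
  change T.dist (treePath hT u w).snd w + 1 = _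
  omega

lemma dist_lt_of_equiv (hT : T.IsTree) (M : Fin n ≃ V) (u v : V) : T.dist u v < n := by
  have : Fintype V := Fintype.ofEquiv _ M
  obtain ⟨p, hp, hlen⟩ := hT.connected.exists_path_of_dist u v
  rw [← hlen]
  have := hp.length_lt
  rwa [Fintype.card_congr M.symm, Fintype.card_fin] at this

variable [DecidableEq V]

lemma algorithmStep_cases [NeZero n] (hT : T.IsTree) (s : State V n) :
    (s.hyp s.current = s.truth s.current ∧
      algorithmStep hT s = { s with finished := s.finished + 1 }) ∨
    ∃ v, algorithmStep hT s = { s with hyp := Function.update s.hyp s.current v } ∧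
      T.dist (s.truth s.current) v + 1 = T.dist (s.truth s.current) (s.hyp s.current) := by
  by_cases h : s.hyp s.current = s.truth s.current
  · exact Or.inl ⟨h, by rw [algorithmStep, oracle, dif_pos h]⟩
  · exact Or.inr ⟨_, by rw [algorithmStep, oracle, dif_neg h], dist_firstDart_snd hT h⟩

lemma truth_algorithmStep [NeZero n] (hT : T.IsTree) (s : State V n) :
    (algorithmStep hT s).truth = s.truth := by
  rcases algorithmStep_cases hT s with ⟨-, h⟩ | ⟨v, h, -⟩ <;> rw [h]

lemma hyp_algorithmStep_of_ne [NeZero n] (hT : T.IsTree) (s : State V n) {l : Fin n}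
    (hl : s.current ≠ l) : (algorithmStep hT s).hyp l = s.hyp l := by
  rcases algorithmStep_cases hT s with ⟨-, h⟩ | ⟨v, h, -⟩ <;> rw [h]
  exact Function.update_of_ne hl.symm _ _

/-- Every step either lowers the distance by one or finishes a label. -/
lemma distance_algorithmStep [NeZero n] (hT : T.IsTree) (s : State V n) :
    (algorithmStep hT s).distance T + 1 + s.finished =
      s.distance T + (algorithmStep hT s).finished := by
  rcases algorithmStep_cases hT s with ⟨-, h⟩ | ⟨v, h, hv⟩ <;> rw [h]
  · simp only [State.distance]
    ring
  · simp only [State.distance]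
    rw [← Finset.add_sum_erase _ _ (Finset.mem_univ s.current),
      ← Finset.add_sum_erase _ (fun l => T.dist (s.truth l) (s.hyp l))
        (Finset.mem_univ s.current), Function.update_self, ← hv]
    have : ∀ l ∈ Finset.univ.erase s.current,
        T.dist (s.truth l) (Function.update s.hyp s.current v l) =
          T.dist (s.truth l) (s.hyp l) := by
      intro l hl
      rw [Function.update_of_ne (Finset.ne_of_mem_erase hl)]
    rw [Finset.sum_congr rfl this]
    ring

/-- The transposition of the endpoints of an edge. -/
def edgeSwap (x : T.edgeSet) : Equiv.Perm V :=
  Sym2.lift ⟨fun u v => Equiv.swap u v, Equiv.swap_comm⟩ x.1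

lemma truth_evolverStep (x : T.edgeSet) (s : State V n) (l : Fin n) :
    (evolverStep x s).truth l = edgeSwap x (s.truth l) := rfl

lemma edgeSwap_of_notMem {x : T.edgeSet} {v : V} (hv : v ∉ x.1) : edgeSwap x v = v := by
  obtain ⟨x, hx⟩ := x
  induction x with
  | _ a b =>
    simp only [Sym2.mem_iff, not_or] at hv
    exact Equiv.swap_apply_of_ne_of_ne hv.1 hv.2

lemma edgeSwap_edgeSwap (x : T.edgeSet) (v : V) : edgeSwap x (edgeSwap x v) = v := by
  obtain ⟨x, hx⟩ := x
  induction x with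
  | _ a b => exact Equiv.swap_apply_self a b v

lemma adj_edgeSwap {x : T.edgeSet} {v : V} (hv : v ∈ x.1) : T.Adj v (edgeSwap x v) := by
  obtain ⟨x, hx⟩ := x
  induction x with
  | _ a b =>
    rw [SimpleGraph.mem_edgeSet] at hx
    rcases Sym2.mem_iff.1 hv with rfl | rfl
    · simpa [edgeSwap] using hx
    · simpa [edgeSwap] using hx.symm

lemma edgeSwap_mem {x : T.edgeSet} {v : V} (hv : v ∈ x.1) : edgeSwap x v ∈ x.1 := by
  by_contra h
  have h1 := edgeSwap_of_notMem h
  rw [edgeSwap_edgeSwap] at h1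
  exact h (h1 ▸ hv)

lemma edgeSwap_mem_iff {x : T.edgeSet} {v : V} : edgeSwap x v ∈ x.1 ↔ v ∈ x.1 :=
  ⟨fun h => edgeSwap_edgeSwap x v ▸ edgeSwap_mem h, edgeSwap_mem⟩

lemma card_filter_mem_edge_le (x : T.edgeSet) (M : Fin n ≃ V) (S : Finset (Fin n)) :
    (S.filter fun l => M l ∈ x.1).card ≤ 2 := by
  obtain ⟨x, hx⟩ := x
  induction x with
  | _ a b =>
    calc _ ≤ ({M.symm a, M.symm b} : Finset (Fin n)).card := by
          refine Finset.card_le_card fun l hl => ?_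
          rw [Finset.mem_filter, Sym2.mem_iff] at hl
          rw [Finset.mem_insert, Finset.mem_singleton, Equiv.eq_symm_apply, Equiv.eq_symm_apply]
          exact hl.2
      _ ≤ 2 := Finset.card_le_two

lemma dist_edgeSwap_le (hT : T.IsTree) (x : T.edgeSet) (v w : V) :
    T.dist (edgeSwap x v) w ≤ T.dist v w + if v ∈ x.1 then 1 else 0 := by
  split_ifs with h
  · have h1 := hT.connected.dist_triangle (u := edgeSwap x v) (v := v) (w := w)
    rw [SimpleGraph.dist_eq_one_iff_adj.2 (adj_edgeSwap h).symm] at h1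
    omega
  · rw [edgeSwap_of_notMem h, add_zero]

lemma sum_dist_evolverStep_le (hT : T.IsTree) (x : T.edgeSet) (s : State V n)
    (S : Finset (Fin n)) :
    ∑ l ∈ S, T.dist ((evolverStep x s).truth l) ((evolverStep x s).hyp l) ≤
      ∑ l ∈ S, T.dist (s.truth l) (s.hyp l) + 2 := by
  calc _ ≤ ∑ l ∈ S, (T.dist (s.truth l) (s.hyp l) + if s.truth l ∈ x.1 then 1 else 0) :=
        Finset.sum_le_sum fun l _ => dist_edgeSwap_le hT x (s.truth l) (s.hyp l)
    _ ≤ _ := by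
        rw [Finset.sum_add_distrib, Finset.sum_boole]
        gcongr
        exact card_filter_mem_edge_le x s.truth S

end Steps

/-! ### Balance of distance, gain and finished labels along a run -/

section Run

variable {V : Type*} [DecidableEq V] {T : SimpleGraph V} {n : ℕ} [NeZero n]
  (hT : T.IsTree) (M₀ : Fin n ≃ V) (H₀ : Fin n → V) (e : ℕ → T.edgeSet)

lemma run_odd (i : ℕ) :
    run hT 2 M₀ H₀ e (2 * i + 1) = algorithmStep hT (run hT 2 M₀ H₀ e (2 * i)) := by
  rw [run, if_neg (by omega)]

lemma run_even (i : ℕ) :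
    run hT 2 M₀ H₀ e (2 * (i + 1)) =
      evolverStep (e i) (algorithmStep hT (run hT 2 M₀ H₀ e (2 * i + 1))) := by
  rw [show 2 * (i + 1) = 2 * i + 1 + 1 by ring, run, if_pos (by omega),
    show (2 * i + 1) / 2 = i by omega]

lemma run_congr {e' : ℕ → T.edgeSet} {t : ℕ} (h : ∀ i < t / 2, e i = e' i) :
    run hT 2 M₀ H₀ e t = run hT 2 M₀ H₀ e' t := by
  induction t with
  | zero => rfl
  | succ t ih =>
    rw [run, run, ih fun i hi => h i (by omega)]
    split_ifs with h2
    · rw [h (t / 2) (by omega)]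
    · rfl

lemma finished_run_succ (t : ℕ) :
    (run hT 2 M₀ H₀ e (t + 1)).finished =
      (algorithmStep hT (run hT 2 M₀ H₀ e t)).finished := by
  rw [run]
  split_ifs <;> rfl

lemma hyp_run_succ (t : ℕ) :
    (run hT 2 M₀ H₀ e (t + 1)).hyp = (algorithmStep hT (run hT 2 M₀ H₀ e t)).hyp := by
  rw [run]
  split_ifs <;> rfl

lemma finished_run_succ_le (t : ℕ) :
    (run hT 2 M₀ H₀ e (t + 1)).finished ≤ (run hT 2 M₀ H₀ e t).finished + 1 := by
  rw [finished_run_succ]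
  rcases algorithmStep_cases hT (run hT 2 M₀ H₀ e t) with ⟨-, h⟩ | ⟨v, h, -⟩ <;> simp [h]

lemma monotone_finished : Monotone fun t => (run hT 2 M₀ H₀ e t).finished := by
  refine monotone_nat_of_le_succ fun t => ?_
  rw [finished_run_succ]
  rcases algorithmStep_cases hT (run hT 2 M₀ H₀ e t) with ⟨-, h⟩ | ⟨v, h, -⟩ <;> simp [h]

/-- The true labeling just before the evolver's step number `i`. -/
noncomputable def truthAt (i : ℕ) : Fin n ≃ V := (run hT 2 M₀ H₀ e (2 * i)).truth

/-- The hypothesized labeling during the evolver's step number `i`. -/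
noncomputable def hypAt (i : ℕ) : Fin n → V := (run hT 2 M₀ H₀ e (2 * (i + 1))).hyp

/-- The amount by which the change of the overall distance in the evolver's step number `i` falls
short of its largest possible value `2`. -/
noncomputable def gain (i : ℕ) : ℤ :=
  2 - ∑ l, ((T.dist (truthAt hT M₀ H₀ e (i + 1) l) (hypAt hT M₀ H₀ e i l) : ℤ) -
    T.dist (truthAt hT M₀ H₀ e i l) (hypAt hT M₀ H₀ e i l))

lemma truthAt_succ (i : ℕ) (l : Fin n) :
    truthAt hT M₀ H₀ e (i + 1) l = edgeSwap (e i) (truthAt hT M₀ H₀ e i l) := by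
  rw [truthAt, run_even, truth_evolverStep, truth_algorithmStep, run_odd, truth_algorithmStep,
    truthAt]

lemma gain_nonneg (i : ℕ) : 0 ≤ gain hT M₀ H₀ e i := by
  have h : ∀ l, (T.dist (truthAt hT M₀ H₀ e (i + 1) l) (hypAt hT M₀ H₀ e i l) : ℤ) -
      T.dist (truthAt hT M₀ H₀ e i l) (hypAt hT M₀ H₀ e i l) ≤
        if truthAt hT M₀ H₀ e i l ∈ (e i).1 then 1 else 0 := by
    intro l
    have := dist_edgeSwap_le hT (e i) (truthAt hT M₀ H₀ e i l) (hypAt hT M₀ H₀ e i l)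
    rw [truthAt_succ]
    zify at this
    linarith
  have h2 := Finset.sum_le_sum fun l (_ : l ∈ Finset.univ) => h l
  rw [Finset.sum_boole] at h2
  have h3 := card_filter_mem_edge_le (e i) (truthAt hT M₀ H₀ e i) Finset.univ
  zify at h3
  rw [gain]
  linarith

lemma distance_run_add_sum_gain (t : ℕ) :
    ((run hT 2 M₀ H₀ e t).distance T : ℤ) + ∑ i ∈ Finset.range (t / 2), gain hT M₀ H₀ e i + t =
      (run hT 2 M₀ H₀ e 0).distance T + (run hT 2 M₀ H₀ e t).finished + 2 * (t / 2 : ℕ) := by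
  induction t with
  | zero => simp [run]
  | succ t ih =>
    have halg := distance_algorithmStep hT (run hT 2 M₀ H₀ e t)
    rw [← finished_run_succ] at halg
    zify at halg
    obtain ⟨i, rfl | rfl⟩ : ∃ i, t = 2 * i ∨ t = 2 * i + 1 := ⟨t / 2, by omega⟩
    · rw [← run_odd] at halg
      rw [show (2 * i + 1) / 2 = i by omega]
      rw [show (2 * i) / 2 = i by omega] at ih
      push_cast at ih ⊢
      linarith
    · rw [show (2 * i + 1 + 1) / 2 = i + 1 by omega, Finset.sum_range_succ]
      rw [show (2 * i + 1) / 2 = i by omega] at ih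
      have hg : gain hT M₀ H₀ e i = 2 + (algorithmStep hT (run hT 2 M₀ H₀ e (2 * i + 1))).distance T
          - (run hT 2 M₀ H₀ e (2 * i + 1 + 1)).distance T := by
        rw [gain, Finset.sum_sub_distrib, State.distance, State.distance,
          show 2 * i + 1 + 1 = 2 * (i + 1) by ring]
        have h1 : hypAt hT M₀ H₀ e i = (algorithmStep hT (run hT 2 M₀ H₀ e (2 * i + 1))).hyp := by
          rw [hypAt, run_even, evolverStep]
        have h2 : truthAt hT M₀ H₀ e i =
            (algorithmStep hT (run hT 2 M₀ H₀ e (2 * i + 1))).truth := by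
          rw [truthAt, truth_algorithmStep, run_odd, truth_algorithmStep]
        rw [← h1, ← h2]
        simp only [truthAt, hypAt]
        push_cast
        ring
      rw [hg]
      push_cast at ih ⊢
      linarith

/-- The elapsed time and twice the number of swaps differ only by parity at the two ends, whence the
additive 1. -/
lemma distance_run_le {t t' : ℕ} (h : t ≤ t') :
    ((run hT 2 M₀ H₀ e t').distance T : ℤ) + ∑ i ∈ Finset.Ico (t / 2) (t' / 2), gain hT M₀ H₀ e i +
      (run hT 2 M₀ H₀ e t).finished ≤
      (run hT 2 M₀ H₀ e t).distance T + (run hT 2 M₀ H₀ e t').finished + 1 := by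
  have h1 := distance_run_add_sum_gain hT M₀ H₀ e t
  have h2 := distance_run_add_sum_gain hT M₀ H₀ e t'
  have h3 := Finset.sum_range_add_sum_Ico (gain hT M₀ H₀ e) (Nat.div_le_div_right (c := 2) h)
  omega

end Run

/-! ### Edges with a common endpoint -/

section Meets

variable {V : Type*} {T : SimpleGraph V}

/-- Two edges meet if they have a common endpoint. -/
def Meets (x y : T.edgeSet) : Prop := ∃ v, v ∈ x.1 ∧ v ∈ y.1

lemma Meets.refl (x : T.edgeSet) : Meets x x := by
  obtain ⟨x, hx⟩ := x
  induction x with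
  | _ a b => exact ⟨a, by simp⟩

lemma Meets.symm {x y : T.edgeSet} (h : Meets x y) : Meets y x :=
  let ⟨v, h1, h2⟩ := h
  ⟨v, h2, h1⟩

end Meets

/-! ### Gain from pairs of cancelling swaps -/

section Cancellation

variable {V : Type*} [DecidableEq V] {T : SimpleGraph V} {n : ℕ} [NeZero n]
  (hT : T.IsTree) (M₀ : Fin n ≃ V) (H₀ : Fin n → V) (e : ℕ → T.edgeSet)

/-- The swaps in between fix both ends of `x`, so a label can neither leave nor enter `x`. The
disjunction allows tracing forwards as well as backwards in time. -/
lemma truthAt_eq_of_not_meets {x : T.edgeSet} {a b : ℕ} (hab : a ≤ b)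
    (hx : ∀ y, a ≤ y → y < b → ¬ Meets x (e y)) {l : Fin n}
    (hl : truthAt hT M₀ H₀ e a l ∈ x.1 ∨ truthAt hT M₀ H₀ e b l ∈ x.1) :
    truthAt hT M₀ H₀ e b l = truthAt hT M₀ H₀ e a l := by
  induction b, hab using Nat.le_induction with
  | base => rfl
  | succ b hab ih =>
    have hb := hx b hab (by omega)
    have hfix : ∀ v ∈ x.1, edgeSwap (e b) v = v := fun v hv =>
      edgeSwap_of_notMem fun hv' => hb ⟨v, hv, hv'⟩
    have ih' := ih fun y h1 h2 => hx y h1 (by omega)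
    rw [truthAt_succ] at hl ⊢
    rcases hl with hl | hl
    · rw [ih' (Or.inl hl), hfix _ hl]
    · have h1 := hfix _ hl
      rw [edgeSwap_edgeSwap] at h1
      rw [← h1] at hl ⊢
      exact ih' (Or.inr hl)

/-- If the same edge is chosen twice, no edge meeting it is chosen in between, and the
hypothesized locations of the labels at its endpoints are the same both times, then the two
swaps cancel. -/
lemma gain_add_gain_eq_four {i₁ i₂ : ℕ} (h12 : i₁ < i₂) (he : e i₁ = e i₂)
    (hbetween : ∀ y, i₁ < y → y < i₂ → ¬ Meets (e i₂) (e y))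
    (hhyp : ∀ l, truthAt hT M₀ H₀ e i₂ l ∈ (e i₂).1 →
      hypAt hT M₀ H₀ e i₁ l = hypAt hT M₀ H₀ e i₂ l) :
    gain hT M₀ H₀ e i₁ + gain hT M₀ H₀ e i₂ = 4 := by
  have key : ∀ l, ((T.dist (truthAt hT M₀ H₀ e (i₁ + 1) l) (hypAt hT M₀ H₀ e i₁ l) : ℤ) -
      T.dist (truthAt hT M₀ H₀ e i₁ l) (hypAt hT M₀ H₀ e i₁ l)) +
      ((T.dist (truthAt hT M₀ H₀ e (i₂ + 1) l) (hypAt hT M₀ H₀ e i₂ l) : ℤ) -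
      T.dist (truthAt hT M₀ H₀ e i₂ l) (hypAt hT M₀ H₀ e i₂ l)) = 0 := by
    intro l
    have hconst := truthAt_eq_of_not_meets hT M₀ H₀ e (x := e i₂) (l := l) (Nat.succ_le_of_lt h12)
      (fun y h1 h2 => hbetween y h1 h2)
    by_cases hl : truthAt hT M₀ H₀ e i₂ l ∈ (e i₂).1
    · have h1 := hconst (Or.inr hl)
      rw [hhyp l hl, truthAt_succ hT M₀ H₀ e i₂, h1, Nat.succ_eq_add_one,
        truthAt_succ hT M₀ H₀ e i₁, he, edgeSwap_edgeSwap]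
      ring
    · have h2 : truthAt hT M₀ H₀ e (i₁ + 1) l ∉ (e i₂).1 := fun h =>
        hl (hconst (Or.inl h) ▸ h)
      rw [truthAt_succ hT M₀ H₀ e i₂, edgeSwap_of_notMem hl]
      rw [truthAt_succ, he, edgeSwap_mem_iff] at h2
      rw [truthAt_succ hT M₀ H₀ e i₁, he, edgeSwap_of_notMem h2]
      ring
  have hsum := Finset.sum_eq_zero fun l (_ : l ∈ Finset.univ) => key l
  rw [Finset.sum_add_distrib] at hsum
  rw [gain, gain]
  linarith

/-- The labels which are current at some time between `2 * a` and `2 * b`. -/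
noncomputable def touched (a b : ℕ) : Finset (Fin n) :=
  (Finset.Icc (run hT 2 M₀ H₀ e (2 * a)).finished (run hT 2 M₀ H₀ e (2 * b)).finished).image
    (Fin.ofNat n)

lemma card_touched_add_le (a b : ℕ) (hab : a ≤ b) :
    (touched hT M₀ H₀ e a b).card + (run hT 2 M₀ H₀ e (2 * a)).finished ≤
      (run hT 2 M₀ H₀ e (2 * b)).finished + 1 := by
  have h1 : (touched hT M₀ H₀ e a b).card ≤ _ := Finset.card_image_le
  have h2 := monotone_finished hT M₀ H₀ e (show 2 * a ≤ 2 * b by omega)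
  simp only [Nat.card_Icc] at h1 h2
  omega

lemma hyp_run_eq {t t' : ℕ} (htt' : t ≤ t') {l : Fin n}
    (hl : ∀ u, t ≤ u → u < t' → (run hT 2 M₀ H₀ e u).current ≠ l) :
    (run hT 2 M₀ H₀ e t').hyp l = (run hT 2 M₀ H₀ e t).hyp l := by
  induction t', htt' using Nat.le_induction with
  | base => rfl
  | succ t' htt' ih =>
    rw [hyp_run_succ, hyp_algorithmStep_of_ne hT _ (hl t' htt' (by omega)),
      ih fun u h1 h2 => hl u h1 (by omega)]

lemma mem_touched_of_hypAt_ne {a b i₁ i₂ : ℕ} (ha : a ≤ i₁) (h12 : i₁ ≤ i₂) (hb : i₂ < b)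
    {l : Fin n} (hl : hypAt hT M₀ H₀ e i₁ l ≠ hypAt hT M₀ H₀ e i₂ l) :
    l ∈ touched hT M₀ H₀ e a b := by
  by_contra hmem
  refine hl (hyp_run_eq hT M₀ H₀ e (by omega) fun u h1 h2 hu => hmem ?_).symm
  rw [touched, Finset.mem_image]
  exact ⟨(run hT 2 M₀ H₀ e u).finished, Finset.mem_Icc.2
    ⟨monotone_finished hT M₀ H₀ e (by omega), monotone_finished hT M₀ H₀ e (by omega)⟩, hu⟩

open Classical in
/-- In a window of `m + j` swaps every hit yields a gain of `4`, up to one hit for every label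
which the algorithm has touched in this window. -/
theorem four_mul_card_hits_le (s m j : ℕ) :
    4 * ((hits Meets m (fun i => e (s + i)) j).card : ℤ) ≤
      ∑ i ∈ Finset.Ico s (s + (m + j)), gain hT M₀ H₀ e i +
      4 * ((run hT 2 M₀ H₀ e (2 * (s + (m + j)))).finished -
        (run hT 2 M₀ H₀ e (2 * s)).finished + 1) := by
  set f : ℕ → T.edgeSet := fun i => e (s + i) with hf
  set 𝓗 := hits Meets m f j with h𝓗
  have hmem : ∀ i ∈ 𝓗, m ≤ i ∧ i < m + j ∧ f i ∈ live Meets m f i := by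
    intro i hi
    simpa [h𝓗, hits, and_assoc] using hi
  have hp : ∀ i, ∃ x, i ∈ 𝓗 → x < m ∧ f x = f i ∧ ∀ y, x < y → y < i → ¬ Meets (f i) (f y) := by
    intro i
    by_cases hi : i ∈ 𝓗
    · obtain ⟨x, hx, -, h1, h2⟩ := exists_of_mem_live (hmem i hi).2.2
      exact ⟨x, fun _ => ⟨hx, h1, h2⟩⟩
    · exact ⟨0, fun h => absurd h hi⟩
  choose p hp using hp
  -- The edge of the later hit was chosen before `m` and is still live, so the earlier hit, whose
  -- index is at least `m`, cannot meet it.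
  have hdisj : ∀ i ∈ 𝓗, ∀ i' ∈ 𝓗, Meets (f i) (f i') → i = i' := by
    have aux : ∀ i ∈ 𝓗, ∀ i' ∈ 𝓗, i < i' → ¬ Meets (f i') (f i) := by
      intro i hi i' hi' hlt
      exact (hp i' hi').2.2 i ((hp i' hi').1.trans_le (hmem i hi).1) hlt
    intro i hi i' hi' hM
    rcases lt_trichotomy i i' with h | h | h
    · exact absurd hM.symm (aux i hi i' hi' h)
    · exact h
    · exact absurd hM (aux i' hi' i hi h)
  set Sp := 𝓗.filter fun i => ∃ l, truthAt hT M₀ H₀ e (s + i) l ∈ (f i).1 ∧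
    hypAt hT M₀ H₀ e (s + p i) l ≠ hypAt hT M₀ H₀ e (s + i) l with hSp
  set U := 𝓗.filter fun i => ¬ ∃ l, truthAt hT M₀ H₀ e (s + i) l ∈ (f i).1 ∧
    hypAt hT M₀ H₀ e (s + p i) l ≠ hypAt hT M₀ H₀ e (s + i) l with hU
  have hcard : Sp.card + U.card = 𝓗.card := Finset.card_filter_add_card_filter_not _
  -- Charge each spoiled hit to a label on its edge whose hypothesis changed between the partner `p
  -- i` and the hit.
  have hspoiled : Sp.card ≤ (touched hT M₀ H₀ e s (s + (m + j))).card := by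
    have hl : ∀ i, ∃ l, i ∈ Sp → truthAt hT M₀ H₀ e (s + i) l ∈ (f i).1 ∧
        hypAt hT M₀ H₀ e (s + p i) l ≠ hypAt hT M₀ H₀ e (s + i) l := by
      intro i
      by_cases hi : i ∈ Sp
      · obtain ⟨l, hl⟩ := (Finset.mem_filter.1 hi).2
        exact ⟨l, fun _ => hl⟩
      · exact ⟨0, fun h => absurd h hi⟩
    choose lab hlab using hl
    refine Finset.card_le_card_of_injOn lab ?_ ?_
    · intro i hi
      have hi𝓗 := (Finset.mem_filter.1 hi).1
      have h1 := hmem i hi𝓗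
      have h2 := hp i hi𝓗
      exact mem_touched_of_hypAt_ne hT M₀ H₀ e (by omega) (by omega) (by omega) (hlab i hi).2
    -- All charged labels are compared at the common moment `s + m`, which lies between every
    -- partner and its hit. There they sit on pairwise disjoint edges, so they are distinct.
    · have hm : ∀ i ∈ Sp, truthAt hT M₀ H₀ e (s + m) (lab i) ∈ (f i).1 := by
        intro i hi
        have hi𝓗 := (Finset.mem_filter.1 hi).1
        have h1 := hmem i hi𝓗
        have h2 := hp i hi𝓗
        rw [← truthAt_eq_of_not_meets hT M₀ H₀ e (x := f i) (b := s + i) (by omega) ?_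
          (Or.inr (hlab i hi).1)]
        · exact (hlab i hi).1
        · intro y hy1 hy2
          have := h2.2.2 (y - s) (by omega) (by omega)
          simpa only [hf, show s + (y - s) = y by omega] using this
      intro i hi i' hi' heq
      refine hdisj i (Finset.mem_filter.1 hi).1 i' (Finset.mem_filter.1 hi').1
        ⟨_, hm i hi, ?_⟩
      rw [heq]
      exact hm i' hi'
  have hpair : ∀ i ∈ U, gain hT M₀ H₀ e (s + p i) + gain hT M₀ H₀ e (s + i) = 4 := by
    intro i hi
    obtain ⟨hi𝓗, hno⟩ := Finset.mem_filter.1 hi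
    have h1 := hmem i hi𝓗
    have h2 := hp i hi𝓗
    push Not at hno
    refine gain_add_gain_eq_four hT M₀ H₀ e (by omega) h2.2.1 ?_ hno
    intro y hy1 hy2
    have := h2.2.2 (y - s) (by omega) (by omega)
    simpa only [hf, show s + (y - s) = y by omega] using this
  have hsumU : 4 * (U.card : ℤ) = ∑ i ∈ U, gain hT M₀ H₀ e (s + p i) +
      ∑ i ∈ U, gain hT M₀ H₀ e (s + i) := by
    rw [← Finset.sum_add_distrib, Finset.sum_congr rfl hpair]
    simp [mul_comm]
  -- Distinct hits have distinct edges, hence distinct partners. As partners precede `m` and hits do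
  -- not, no gain is counted twice.
  have hinj : Set.InjOn p U := by
    intro i hi i' hi' heq
    have hi := (Finset.mem_filter.1 hi).1
    have hi' := (Finset.mem_filter.1 hi').1
    refine hdisj i hi i' hi' ?_
    rw [← (hp i hi).2.1, ← (hp i' hi').2.1, heq]
    exact Meets.refl _
  have hfirst : ∑ i ∈ U, gain hT M₀ H₀ e (s + p i) ≤
      ∑ i ∈ Finset.range m, gain hT M₀ H₀ e (s + i) := by
    rw [← Finset.sum_image (f := fun i => gain hT M₀ H₀ e (s + i)) hinj]
    refine Finset.sum_le_sum_of_subset_of_nonneg ?_ fun i _ _ => gain_nonneg hT M₀ H₀ e _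
    intro x hx
    obtain ⟨i, hi, rfl⟩ := Finset.mem_image.1 hx
    exact Finset.mem_range.2 (hp i (Finset.mem_filter.1 hi).1).1
  have hsecond : ∑ i ∈ U, gain hT M₀ H₀ e (s + i) ≤
      ∑ i ∈ Finset.Ico m (m + j), gain hT M₀ H₀ e (s + i) := by
    refine Finset.sum_le_sum_of_subset_of_nonneg ?_ fun i _ _ => gain_nonneg hT M₀ H₀ e _
    intro i hi
    have h1 := hmem i (Finset.mem_filter.1 hi).1
    exact Finset.mem_Ico.2 ⟨h1.1, h1.2.1⟩
  have hsplit : ∑ i ∈ Finset.Ico s (s + (m + j)), gain hT M₀ H₀ e i =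
      ∑ i ∈ Finset.range m, gain hT M₀ H₀ e (s + i) +
      ∑ i ∈ Finset.Ico m (m + j), gain hT M₀ H₀ e (s + i) := by
    rw [Finset.sum_range_add_sum_Ico _ (by omega), Finset.sum_Ico_eq_sum_range,
      show s + (m + j) - s = m + j by omega]
  have htouched := card_touched_add_le hT M₀ H₀ e s (s + (m + j)) (by omega)
  omega

end Cancellation

/-! ### Every iteration starts, and what it leaves behind -/

section Iterations

variable {V : Type*} [DecidableEq V] {T : SimpleGraph V} {n : ℕ} [NeZero n]
  (hT : T.IsTree) (M₀ : Fin n ≃ V) (H₀ : Fin n → V) (e : ℕ → T.edgeSet)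

lemma dist_algorithmStep_le (s : State V n) (l : Fin n) :
    T.dist ((algorithmStep hT s).truth l) ((algorithmStep hT s).hyp l) ≤
      T.dist (s.truth l) (s.hyp l) := by
  rcases algorithmStep_cases hT s with ⟨-, h⟩ | ⟨v, h, hv⟩ <;> rw [h]
  by_cases hl : l = s.current
  · subst hl
    simp only [Function.update_self]
    omega
  · simp only [Function.update_of_ne hl, le_refl]

lemma finished_algorithmStep_eq_iff (s : State V n) :
    (algorithmStep hT s).finished = s.finished + 1 ↔
      T.dist (s.truth s.current) (s.hyp s.current) = 0 := by
  rcases algorithmStep_cases hT s with ⟨h0, h⟩ | ⟨v, h, hv⟩ <;> rw [h]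
  · simp [h0]
  · simp only [Nat.left_eq_add, one_ne_zero, false_iff]
    omega

lemma finished_algorithmStep_of_pos (s : State V n)
    (h0 : 0 < T.dist (s.truth s.current) (s.hyp s.current)) :
    (algorithmStep hT s).finished = s.finished ∧ (algorithmStep hT s).current = s.current ∧
      T.dist ((algorithmStep hT s).truth s.current) ((algorithmStep hT s).hyp s.current) + 1 =
        T.dist (s.truth s.current) (s.hyp s.current) := by
  rcases algorithmStep_cases hT s with ⟨h1, -⟩ | ⟨v, h, hv⟩
  · simp [h1] at h0
  · rw [h]
    refine ⟨rfl, rfl, ?_⟩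
    simpa using hv

/-- From an even time two algorithm steps precede the next swap. Unless they finish the label, they
bring it 2 closer while the swap takes back at most 1, so the distance drops every two time units.
-/
lemma exists_finished_lt_of_even (d i : ℕ)
    (hd : T.dist ((run hT 2 M₀ H₀ e (2 * i)).truth (run hT 2 M₀ H₀ e (2 * i)).current)
      ((run hT 2 M₀ H₀ e (2 * i)).hyp (run hT 2 M₀ H₀ e (2 * i)).current) ≤ d) :
    ∃ t ≤ 2 * i + 2 * d + 2,
      (run hT 2 M₀ H₀ e (2 * i)).finished < (run hT 2 M₀ H₀ e t).finished := by
  induction d generalizing i with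
  | zero =>
    refine ⟨2 * i + 1, by omega, ?_⟩
    rw [run_odd, (finished_algorithmStep_eq_iff hT _).2 (by omega)]
    omega
  | succ d ih =>
    set s := run hT 2 M₀ H₀ e (2 * i) with hs
    rcases Nat.eq_zero_or_pos (T.dist (s.truth s.current) (s.hyp s.current)) with h0 | h0
    · refine ⟨2 * i + 1, by omega, ?_⟩
      rw [run_odd, (finished_algorithmStep_eq_iff hT _).2 h0]
      omega
    obtain ⟨hf1, hc1, hd1⟩ := finished_algorithmStep_of_pos hT s h0
    rw [hs, ← run_odd] at hf1 hc1 hd1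
    rw [← hs] at hf1 hc1 hd1
    set s' := run hT 2 M₀ H₀ e (2 * i + 1) with hs'
    rcases Nat.eq_zero_or_pos (T.dist (s'.truth s'.current) (s'.hyp s'.current)) with h0' | h0'
    · refine ⟨2 * i + 1 + 1, by omega, ?_⟩
      rw [finished_run_succ, (finished_algorithmStep_eq_iff hT _).2 h0', hf1]
      omega
    obtain ⟨hf2, hc2, hd2⟩ := finished_algorithmStep_of_pos hT s' h0'
    have hrun : run hT 2 M₀ H₀ e (2 * (i + 1)) = evolverStep (e i) (algorithmStep hT s') :=
      run_even hT M₀ H₀ e i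
    have hcur : (run hT 2 M₀ H₀ e (2 * (i + 1))).current = s.current := by
      rw [hrun, ← hc1, ← hc2]
      rfl
    have hfin : (run hT 2 M₀ H₀ e (2 * (i + 1))).finished = s.finished := by
      rw [hrun, ← hf1, ← hf2]
      rfl
    have hdist := dist_edgeSwap_le hT (e i) ((algorithmStep hT s').truth s.current)
      ((algorithmStep hT s').hyp s.current)
    have hle : (if (algorithmStep hT s').truth s.current ∈ (e i).1 then 1 else 0) ≤ 1 := by
      split_ifs <;> simp
    rw [hc1] at hd2
    obtain ⟨t, ht, hlt⟩ := ih (i + 1) (by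
      rw [hcur, hrun]
      change T.dist (edgeSwap (e i) ((algorithmStep hT s').truth s.current))
        ((algorithmStep hT s').hyp s.current) ≤ d
      omega)
    exact ⟨t, by omega, hfin ▸ hlt⟩

lemma exists_finished_eq {t t' f : ℕ} (htt' : t ≤ t')
    (h1 : (run hT 2 M₀ H₀ e t).finished ≤ f) (h2 : f ≤ (run hT 2 M₀ H₀ e t').finished) :
    ∃ u, t ≤ u ∧ u ≤ t' ∧ (run hT 2 M₀ H₀ e u).finished = f := by
  induction t', htt' using Nat.le_induction with
  | base => exact ⟨t, le_rfl, le_rfl, by omega⟩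
  | succ t' htt' ih =>
    by_cases h : f ≤ (run hT 2 M₀ H₀ e t').finished
    · obtain ⟨u, hu1, hu2, hu⟩ := ih h
      exact ⟨u, hu1, by omega, hu⟩
    · have := finished_run_succ_le hT M₀ H₀ e t'
      exact ⟨t' + 1, by omega, le_rfl, by omega⟩

lemma exists_finished_eq_succ (t : ℕ) :
    ∃ t', t ≤ t' ∧ t' ≤ t + (2 * n + 1) ∧
      (run hT 2 M₀ H₀ e t').finished = (run hT 2 M₀ H₀ e t).finished + 1 := by
  suffices h : ∃ t', t ≤ t' ∧ t' ≤ t + (2 * n + 1) ∧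
      (run hT 2 M₀ H₀ e t).finished + 1 ≤ (run hT 2 M₀ H₀ e t').finished by
    obtain ⟨t', h1, h2, h3⟩ := h
    obtain ⟨u, hu1, hu2, hu⟩ := exists_finished_eq hT M₀ H₀ e h1 (Nat.le_succ _) h3
    exact ⟨u, hu1, by omega, hu⟩
  -- Waiting for an even time costs at most 1, and a distance of at most `n - 1` then costs at most
  -- `2 * n`.
  obtain ⟨i, hi⟩ : ∃ i, t ≤ 2 * i ∧ 2 * i ≤ t + 1 := ⟨(t + 1) / 2, by omega⟩
  have hlt := dist_lt_of_equiv hT M₀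
    ((run hT 2 M₀ H₀ e (2 * i)).truth (run hT 2 M₀ H₀ e (2 * i)).current)
    ((run hT 2 M₀ H₀ e (2 * i)).hyp (run hT 2 M₀ H₀ e (2 * i)).current)
  obtain ⟨t', ht', hf⟩ := exists_finished_lt_of_even hT M₀ H₀ e (n - 1) i (by omega)
  have hmono := monotone_finished hT M₀ H₀ e hi.1
  simp only at hmono
  refine ⟨t', ?_, by omega, by omega⟩
  by_contra hcon
  have h2 := monotone_finished hT M₀ H₀ e (show t' ≤ 2 * i by omega)
  simp only at h2
  omega

lemma exists_finished_eq_add (t x : ℕ) :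
    ∃ t', t ≤ t' ∧ t' ≤ t + x * (2 * n + 1) ∧
      (run hT 2 M₀ H₀ e t').finished = (run hT 2 M₀ H₀ e t).finished + x := by
  induction x with
  | zero => exact ⟨t, le_rfl, by omega, rfl⟩
  | succ x ih =>
    obtain ⟨t', h1, h2, h3⟩ := ih
    obtain ⟨t'', h4, h5, h6⟩ := exists_finished_eq_succ hT M₀ H₀ e t'
    refine ⟨t'', by omega, ?_, by omega⟩
    rw [add_mul]
    omega

/-- The number of finished labels grows by at most one per step, so it takes the value `n * a`
exactly when the iteration begins. -/
lemma startsIteration_succ_iff {a t : ℕ} :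
    StartsIteration (run hT 2 M₀ H₀ e) (a + 1) t ↔
      (run hT 2 M₀ H₀ e t).finished = n * a ∧
        ∀ u < t, (run hT 2 M₀ H₀ e u).finished < n * a := by
  have hn : 0 < n := Nat.pos_of_ne_zero (NeZero.ne n)
  have hiter : ∀ u, (run hT 2 M₀ H₀ e u).iteration = a + 1 ↔
      n * a ≤ (run hT 2 M₀ H₀ e u).finished ∧ (run hT 2 M₀ H₀ e u).finished < n * a + n := by
    intro u
    rw [State.iteration, add_left_inj, Nat.div_eq_iff hn, mul_comm a n]
    omega
  constructor
  · rintro ⟨h1, h2⟩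
    have h1 := (hiter t).1 h1
    have h3 : ∀ u < t, (run hT 2 M₀ H₀ e u).finished < n * a := by
      intro u hu
      by_contra hcon
      have hmono := monotone_finished hT M₀ H₀ e hu.le
      simp only at hmono
      have := h2 ((hiter u).2 ⟨by omega, by omega⟩)
      omega
    refine ⟨?_, h3⟩
    rcases t with - | t
    · have : (run hT 2 M₀ H₀ e 0).finished = 0 := rfl
      omega
    · have := finished_run_succ_le hT M₀ H₀ e t
      have := h3 t (by omega)
      omega
  · rintro ⟨h1, h2⟩
    refine ⟨(hiter t).2 ⟨by omega, by omega⟩, fun u hu => ?_⟩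
    by_contra hcon
    have := h2 u (by omega)
    have := (hiter u).1 hu
    omega

lemma startsIteration_one : StartsIteration (run hT 2 M₀ H₀ e) 1 0 :=
  (startsIteration_succ_iff hT M₀ H₀ e (a := 0)).2 ⟨rfl, by simp⟩

lemma StartsIteration.exists_succ {a t : ℕ}
    (h : StartsIteration (run hT 2 M₀ H₀ e) (a + 1) t) :
    ∃ t', t ≤ t' ∧ t' ≤ t + n * (2 * n + 1) ∧
      StartsIteration (run hT 2 M₀ H₀ e) (a + 1 + 1) t' := by
  classical
  rw [startsIteration_succ_iff] at h
  obtain ⟨t', h1, h2, h3⟩ := exists_finished_eq_add hT M₀ H₀ e t n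
  have hex : ∃ u, (run hT 2 M₀ H₀ e u).finished = n * (a + 1) := ⟨t', by rw [h3, h.1]; ring⟩
  refine ⟨Nat.find hex, ?_, (Nat.find_min' hex (by rw [h3, h.1]; ring)).trans h2, ?_⟩
  · by_contra hcon
    have h4 := h.2 _ (not_le.1 hcon)
    rw [Nat.find_spec hex, mul_add] at h4
    omega
  · rw [startsIteration_succ_iff]
    refine ⟨Nat.find_spec hex, fun u hu => lt_of_le_of_ne ?_ (Nat.find_min hex hu)⟩
    have := monotone_finished hT M₀ H₀ e hu.le
    rwa [← Nat.find_spec hex]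

lemma exists_startsIteration (a : ℕ) :
    ∃ t, StartsIteration (run hT 2 M₀ H₀ e) (a + 1) t := by
  induction a with
  | zero => exact ⟨0, startsIteration_one hT M₀ H₀ e⟩
  | succ a ih =>
    obtain ⟨t, ht⟩ := ih
    obtain ⟨t', -, -, h⟩ := ht.exists_succ
    exact ⟨t', h⟩

lemma distance_run_le_sq (t : ℕ) : (run hT 2 M₀ H₀ e t).distance T ≤ n * n := by
  rw [State.distance]
  calc _ ≤ ∑ _l : Fin n, n :=
        Finset.sum_le_sum fun l _ => (dist_lt_of_equiv hT M₀ _ _).le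
    _ = n * n := by simp

/-- The labels processed since the start of an iteration are displaced only by the evolver. -/
lemma sum_dist_processed_le {a t u : ℕ} (htu : t ≤ u)
    (ht : (run hT 2 M₀ H₀ e t).finished = n * a)
    (hu : (run hT 2 M₀ H₀ e u).finished ≤ n * a + n) :
    ∑ l ∈ Finset.univ.filter (fun l : Fin n => l.val < (run hT 2 M₀ H₀ e u).finished - n * a),
      T.dist ((run hT 2 M₀ H₀ e u).truth l) ((run hT 2 M₀ H₀ e u).hyp l) + 2 * (t / 2) ≤
        2 * (u / 2) := by
  induction u, htu using Nat.le_induction with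
  | base => simp [ht]
  | succ u htu ih =>
    set s := run hT 2 M₀ H₀ e u with hs
    have hmono := monotone_finished hT M₀ H₀ e htu
    have hmono' := monotone_finished hT M₀ H₀ e (Nat.le_succ u)
    simp only [Nat.succ_eq_add_one, ← hs, ht] at hmono hmono'
    have ih := ih (by omega)
    have halg : ∑ l ∈ Finset.univ.filter
        (fun l : Fin n => l.val < (algorithmStep hT s).finished - n * a),
        T.dist ((algorithmStep hT s).truth l) ((algorithmStep hT s).hyp l) ≤
        ∑ l ∈ Finset.univ.filter (fun l : Fin n => l.val < s.finished - n * a),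
          T.dist (s.truth l) (s.hyp l) := by
      refine (Finset.sum_le_sum fun l _ => dist_algorithmStep_le hT s l).trans ?_
      rw [finished_run_succ, ← hs] at hu
      by_cases h0 : T.dist (s.truth s.current) (s.hyp s.current) = 0
      · have hfin := (finished_algorithmStep_eq_iff hT s).2 h0
        rw [hfin] at hu ⊢
        have hcur : s.current.val = s.finished - n * a := by
          change s.finished % n = _
          obtain ⟨x, hx⟩ := Nat.exists_eq_add_of_le hmono
          rw [hx, Nat.mul_add_mod, Nat.mod_eq_of_lt (by omega)]
          omega
        have hset : Finset.univ.filter (fun l : Fin n => l.val < s.finished + 1 - n * a) =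
            insert s.current (Finset.univ.filter fun l : Fin n => l.val < s.finished - n * a) := by
          ext l
          simp only [Finset.mem_filter, Finset.mem_univ, true_and, Finset.mem_insert, Fin.ext_iff]
          omega
        rw [hset, Finset.sum_insert (by simp [hcur]), h0, zero_add]
      · rw [(finished_algorithmStep_of_pos hT s (by omega)).1]
    rw [run, ← hs]
    split_ifs with h2
    · have hev := sum_dist_evolverStep_le hT (e (u / 2)) (algorithmStep hT s)
        (Finset.univ.filter fun l : Fin n => l.val < (algorithmStep hT s).finished - n * a)
      have hfin : (evolverStep (e (u / 2)) (algorithmStep hT s)).finished =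
        (algorithmStep hT s).finished := rfl
      rw [hfin]
      omega
    · omega

lemma distance_le_two_mul {a t t' : ℕ} (htt' : t ≤ t')
    (ht : (run hT 2 M₀ H₀ e t).finished = n * a)
    (ht' : (run hT 2 M₀ H₀ e t').finished = n * (a + 1)) :
    (run hT 2 M₀ H₀ e t').distance T + 2 * (t / 2) ≤ 2 * (t' / 2) := by
  have h := sum_dist_processed_le hT M₀ H₀ e htt' ht (by rw [ht']; exact le_of_eq (by ring))
  rw [ht', Finset.filter_true_of_mem] at h
  · exact h
  · intro l _
    rw [mul_add, mul_one, Nat.add_sub_cancel_left]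
    exact l.2

end Iterations

/-! ### Contraction of the distance over iterations -/

section Contraction

variable {V : Type*} [DecidableEq V] {T : SimpleGraph V} {n : ℕ} [NeZero n]
  (hT : T.IsTree) (M₀ : Fin n ≃ V) (H₀ : Fin n → V) (e : ℕ → T.edgeSet)

open Classical in
/-- The window of `m + j` evolver steps beginning with step `s` has at least `h` hits. -/
def GoodWindow (m j h s : ℕ) (e : ℕ → T.edgeSet) : Prop :=
  h ≤ (hits Meets m (fun i => e (s + i)) j).card

/-- The loss of 4 per window allows for the label being processed at a window boundary, which both
neighbouring windows count as touched. -/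
lemma mul_le_sum_gain_add {m j ρ s q : ℕ}
    (hgood : ∀ q' < q, GoodWindow m j (2 * ρ) (s + q' * (m + j)) e) :
    (q : ℤ) * (8 * ρ - 4) ≤
      ∑ i ∈ Finset.Ico s (s + q * (m + j)), gain hT M₀ H₀ e i +
      4 * ((run hT 2 M₀ H₀ e (2 * (s + q * (m + j)))).finished -
        (run hT 2 M₀ H₀ e (2 * s)).finished) := by
  induction q with
  | zero => simp
  | succ q ih =>
    have ih := ih fun q' hq' => hgood q' (by omega)
    have h1 := four_mul_card_hits_le hT M₀ H₀ e (s + q * (m + j)) m j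
    have h2 := hgood q (by omega)
    rw [GoodWindow] at h2
    have hs : s + (q + 1) * (m + j) = s + q * (m + j) + (m + j) := by ring
    rw [hs, ← Finset.sum_Ico_consecutive _ (Nat.le_add_right s (q * (m + j)))
      (Nat.le_add_right _ (m + j))]
    zify at h2
    push_cast at ih ⊢
    linarith

/-- One iteration shrinks the overall distance by a constant factor, up to an additive `O(n)`. -/
lemma distance_contraction {a t t' m j ρ c : ℕ} (hρ : 0 < ρ) (hρn : ρ ≤ n) (hc : 0 < c)
    (hw0 : 0 < m + j) (hw : m + j ≤ 2 * c * ρ) (htt' : t ≤ t')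
    (ht : (run hT 2 M₀ H₀ e t).finished = n * a)
    (ht' : (run hT 2 M₀ H₀ e t').finished = n * (a + 1))
    (hgood : ∀ s, (t + 1) / 2 ≤ s → 2 * s < t' → GoodWindow m j (2 * ρ) s e) :
    ((run hT 2 M₀ H₀ e t').distance T : ℝ) * (1 + 1 / c) ≤
      (run hT 2 M₀ H₀ e t).distance T + 12 * n := by
  have hn : 0 < n := Nat.pos_of_ne_zero (NeZero.ne n)
  set w := m + j with hwdef
  -- Rounding up makes the windows begin no earlier than time `t`, so that they use only swaps made
  -- after the iteration has started.
  set s := (t + 1) / 2 with hs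
  set q := (t' / 2 - s) / w with hq
  have hqw : q * w ≤ t' / 2 - s := Nat.div_mul_le_self _ _
  have hqw' : t' / 2 - s < (q + 1) * w := by
    rw [mul_comm]
    exact Nat.lt_mul_div_succ _ hw0
  have hD1 := distance_le_two_mul hT M₀ H₀ e htt' ht ht'
  have hD2 := distance_run_le hT M₀ H₀ e htt'
  -- Of the `5 * n`, null answers cost `n` and touched labels `4 * n`; the 1 comes from parity.
  -- Since `ρ ≥ 1`, each window still gains `8 * ρ - 4 ≥ 4 * ρ`.
  have hmain : (run hT 2 M₀ H₀ e t').distance T + (q : ℤ) * (4 * ρ) ≤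
      (run hT 2 M₀ H₀ e t).distance T + 5 * n + 1 := by
    have hq4 : (q : ℤ) * (4 * ρ) ≤ q * (8 * ρ - 4) := by
      gcongr
      omega
    have hge : 0 ≤ ∑ i ∈ Finset.Ico (t / 2) (t' / 2), gain hT M₀ H₀ e i :=
      Finset.sum_nonneg fun i _ => gain_nonneg hT M₀ H₀ e i
    rw [ht, ht'] at hD2
    push_cast at hD2
    rw [mul_add, mul_one] at hD2
    rcases Nat.eq_zero_or_pos q with hq0 | hq0
    · rw [hq0]
      push_cast
      linarith
    have hpos : 0 < q * w := Nat.mul_pos hq0 hw0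
    have h1 := mul_le_sum_gain_add hT M₀ H₀ e (m := m) (j := j) (ρ := ρ) (s := s) (q := q) (by
      intro q' hq'
      refine hgood _ (by omega) ?_
      have : q' * w + w ≤ q * w := by
        rw [← Nat.succ_mul]
        exact Nat.mul_le_mul_right _ hq'
      rw [← hwdef]
      omega)
    rw [← hwdef] at h1
    have hsub : ∑ i ∈ Finset.Ico s (s + q * w), gain hT M₀ H₀ e i ≤
        ∑ i ∈ Finset.Ico (t / 2) (t' / 2), gain hT M₀ H₀ e i := by
      refine Finset.sum_le_sum_of_subset_of_nonneg ?_ fun i _ _ => gain_nonneg hT M₀ H₀ e _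
      exact Finset.Ico_subset_Ico (by omega) (by omega)
    have hF1 := monotone_finished hT M₀ H₀ e (show t ≤ 2 * s by omega)
    have hF2 := monotone_finished hT M₀ H₀ e (show 2 * (s + q * w) ≤ t' by omega)
    simp only [ht] at hF1
    simp only [ht'] at hF2
    rw [← Int.ofNat_le] at hF1 hF2
    push_cast at hF1 hF2
    rw [mul_add (n : ℤ), mul_one] at hF2
    linarith
  have hD1' : (run hT 2 M₀ H₀ e t').distance T ≤ 2 * ((q + 1) * w) + 2 := by omega
  have hD3 : (run hT 2 M₀ H₀ e t').distance T ≤ 2 * ((q + 1) * (2 * c * ρ)) + 2 :=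
    hD1'.trans (by gcongr)
  have hmainR : ((run hT 2 M₀ H₀ e t').distance T : ℝ) + q * (4 * ρ) ≤
      (run hT 2 M₀ H₀ e t).distance T + 5 * n + 1 := by exact_mod_cast hmain
  have hD3R : ((run hT 2 M₀ H₀ e t').distance T : ℝ) ≤ 2 * ((q + 1) * (2 * c * ρ)) + 2 := by
    exact_mod_cast hD3
  have hcR : (1 : ℝ) ≤ c := by exact_mod_cast hc
  have hnR : (1 : ℝ) ≤ n := by exact_mod_cast hn
  have hρR : (ρ : ℝ) ≤ n := by exact_mod_cast hρn
  -- The number of complete windows is bounded below through the distance; the term `4 * ρ` pays for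
  -- the incomplete last window.
  have hdiv : ((run hT 2 M₀ H₀ e t').distance T : ℝ) * (1 / c) ≤ q * (4 * ρ) + 4 * ρ + 2 := by
    rw [mul_one_div, div_le_iff₀ (by linarith)]
    nlinarith
  linarith

/-- The map `x ↦ (x + 12 * n) / (1 + 1 / c)` fixes `12 * c * n`, and the excess over it, at most `n
* n` initially, decays geometrically. An iteration lasts at most `n * (2 * n + 1)` time units, which
bounds the stretch where good windows are needed. -/
lemma exists_startsIteration_distance_le {a t m j ρ c : ℕ} (hρ : 0 < ρ) (hρn : ρ ≤ n)
    (hc : 0 < c) (hw0 : 0 < m + j) (hw : m + j ≤ 2 * c * ρ)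
    (ht : StartsIteration (run hT 2 M₀ H₀ e) (a + 1) t) (z : ℕ)
    (hgood : ∀ s, (t + 1) / 2 ≤ s → 2 * s < t + z * (n * (2 * n + 1)) →
      GoodWindow m j (2 * ρ) s e) :
    ∃ t', t ≤ t' ∧ t' ≤ t + z * (n * (2 * n + 1)) ∧
      StartsIteration (run hT 2 M₀ H₀ e) (a + z + 1) t' ∧
      ((run hT 2 M₀ H₀ e t').distance T : ℝ) ≤ n * n / (1 + 1 / c) ^ z + 12 * c * n := by
  have hcR : (0 : ℝ) < c := by exact_mod_cast hc
  induction z with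
  | zero =>
    refine ⟨t, le_rfl, by omega, ht, ?_⟩
    have : ((run hT 2 M₀ H₀ e t).distance T : ℝ) ≤ n * n := by
      exact_mod_cast distance_run_le_sq hT M₀ H₀ e t
    simp only [pow_zero, div_one]
    have h2 : (0 : ℝ) ≤ 12 * c * n := by positivity
    linarith
  | succ z ih =>
    obtain ⟨t', h1, h2, h3, h4⟩ := ih fun s hs1 hs2 => hgood s hs1 (by rw [add_mul]; omega)
    obtain ⟨t'', h5, h6, h7⟩ := h3.exists_succ
    refine ⟨t'', by omega, by rw [add_mul]; omega, h7, ?_⟩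
    have hcon := distance_contraction hT M₀ H₀ e hρ hρn hc hw0 hw h5
      ((startsIteration_succ_iff hT M₀ H₀ e).1 h3).1 ((startsIteration_succ_iff hT M₀ H₀ e).1 h7).1
      (fun s hs1 hs2 => hgood s (by omega) (by rw [add_mul]; omega))
    have hpos : (0 : ℝ) < 1 + 1 / c := by positivity
    rw [← le_div_iff₀ hpos] at hcon
    refine hcon.trans ?_
    rw [div_le_iff₀ hpos]
    calc ((run hT 2 M₀ H₀ e t').distance T : ℝ) + 12 * n
        ≤ n * n / (1 + 1 / c) ^ z + 12 * c * n + 12 * n := by linarith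
      _ = _ := by
        rw [add_mul, pow_succ, ← div_div, div_mul_cancel₀ _ hpos.ne']
        field_simp
        ring

end Contraction

/-! ### Which swaps determine an event -/

section Locality

variable {V : Type*} [DecidableEq V] {T : SimpleGraph V} {n : ℕ}

lemma dependsOn_goodWindow (m j h s : ℕ) :
    DependsOn (fun e : ℕ → T.edgeSet => GoodWindow m j h s e) (Finset.Ico s (s + (m + j))) := by
  classical
  intro e e' he
  simp only [GoodWindow]
  rw [hits_congr fun x hx => he (s + x) (by simp; omega)]

variable [NeZero n] (hT : T.IsTree) (M₀ : Fin n ≃ V) (H₀ : Fin n → V)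

lemma dependsOn_startsIteration (a t : ℕ) :
    DependsOn (fun e : ℕ → T.edgeSet => StartsIteration (run hT 2 M₀ H₀ e) (a + 1) t)
      (Finset.range (t / 2)) := by
  intro e e' h
  have hrun : ∀ u ≤ t, run hT 2 M₀ H₀ e u = run hT 2 M₀ H₀ e' u := fun u hu =>
    run_congr hT M₀ H₀ e fun i hi => h i (by simp; omega)
  simp only [startsIteration_succ_iff, hrun t le_rfl]
  refine propext (and_congr_right fun _ => forall_congr' fun u => forall_congr' fun hu => ?_)
  rw [hrun u (le_of_lt hu)]

end Locality

/-! ### Bounded degree bounds the number of edges meeting an edge -/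

section Degree

variable {V : Type*} [Fintype V] {T : SimpleGraph V} [DecidableRel T.Adj]

open Classical in
lemma card_meets_le (x : T.edgeSet) :
    (Finset.univ.filter fun y => Meets x y).card ≤ 2 * T.maxDegree := by
  obtain ⟨x, hx⟩ := x
  induction x with
  | _ a b =>
    calc _ = ((Finset.univ.filter fun y : T.edgeSet => Meets ⟨s(a, b), hx⟩ y).image
            Subtype.val).card := (Finset.card_image_of_injective _ Subtype.val_injective).symm
      _ ≤ (T.incidenceFinset a ∪ T.incidenceFinset b).card := by
          refine Finset.card_le_card fun y hy => ?_
          obtain ⟨y, hy', rfl⟩ := Finset.mem_image.1 hy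
          obtain ⟨v, hv1, hv2⟩ := (Finset.mem_filter.1 hy').2
          rw [Finset.mem_union, SimpleGraph.mem_incidenceFinset, SimpleGraph.mem_incidenceFinset]
          rcases Sym2.mem_iff.1 hv1 with rfl | rfl
          · exact Or.inl ⟨y.2, hv2⟩
          · exact Or.inr ⟨y.2, hv2⟩
      _ ≤ _ := Finset.card_union_le _ _
      _ ≤ 2 * T.maxDegree := by
          rw [SimpleGraph.card_incidenceFinset_eq_degree,
            SimpleGraph.card_incidenceFinset_eq_degree, two_mul]
          exact add_le_add (T.degree_le_maxDegree a) (T.degree_le_maxDegree b)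

end Degree

/-! ### Union bound over windows after a random starting time -/

section Probability

variable {V : Type*} [Fintype V] [DecidableEq V] {T : SimpleGraph V} [DecidableRel T.Adj] {n : ℕ}

variable {Ω : Type*} [MeasurableSpace Ω] {μ : Measure Ω} [IsProbabilityMeasure μ]
  {E : ℕ → Ω → T.edgeSet}

lemma measure_not_goodWindow_le (hE : IsUniformEvolver μ E) {κ r K ρ : ℕ}
    (hdeg : 2 * T.maxDegree ≤ κ) (hκ : 0 < κ) (hK : 0 < K) (hrK : r = 8 * K * ρ)
    (hr : Fintype.card T.edgeSet ≤ 2 * K * r) (hr' : 960 * κ ^ 3 * r ≤ Fintype.card T.edgeSet)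
    (s : ℕ) :
    μ {ω | ¬ GoodWindow (8 * κ * r) (2 * r) (2 * ρ) s fun i => E i ω} ≤
      ENNReal.ofReal (2 * Real.exp (-ρ)) := by
  classical
  let _ : MeasurableSpace T.edgeSet := ⊤
  have hm : ∀ i, Measurable (E i) := fun i => measurable_to_countable' fun x => hE.measurable i x
  have hind : iIndepFun (fun i => E (s + i)) μ :=
    iIndepFun.precomp (g := fun i => s + i) (add_right_injective s) hE.indep
  have h := measure_window_le (R := Meets) hind (fun i => hm (s + i))
    (fun i x => by rw [hE.uniform, Nat.card_eq_fintype_card]) Meets.refl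
    (fun _ _ h => h.symm) (fun x => (card_meets_le x).trans hdeg) hκ hK hrK hr hr'
  refine le_trans (measure_mono fun ω hω => ?_) h
  simp only [Set.mem_ofPred_eq, GoodWindow, not_le] at hω ⊢
  convert hω

variable [NeZero n] (hT : T.IsTree) (M₀ : Fin n ≃ V) (H₀ : Fin n → V)

/-- With high probability all windows in a stretch of time following the start of a given
iteration are good. -/
lemma measure_exists_not_goodWindow_le (hE : IsUniformEvolver μ E) {m j h : ℕ} {ε : ℝ≥0∞}
    (hε : ∀ s, μ {ω | ¬ GoodWindow m j h s fun i => E i ω} ≤ ε) (a Q : ℕ) :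
    μ {ω | ∃ t, StartsIteration (run hT 2 M₀ H₀ fun i => E i ω) (a + 1) t ∧
      ∃ s, (t + 1) / 2 ≤ s ∧ 2 * s < t + Q ∧ ¬ GoodWindow m j h s fun i => E i ω} ≤ Q * ε := by
  let _ : MeasurableSpace T.edgeSet := ⊤
  have hm : ∀ i, Measurable (E i) := fun i => measurable_to_countable' fun x => hE.measurable i x
  set A : ℕ → Set Ω := fun t =>
    {ω | StartsIteration (run hT 2 M₀ H₀ fun i => E i ω) (a + 1) t} with hA
  set B : ℕ → Set Ω := fun s => {ω | ¬ GoodWindow m j h s fun i => E i ω} with hB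
  have hAmeas : ∀ t, MeasurableSet (A t) := fun t =>
    measurable_comp_of_dependsOn hm (dependsOn_startsIteration hT M₀ H₀ a t)
      (MeasurableSet.of_discrete (s := {True})) |>.congr (by ext; simp [hA])
  have hAdisj : Pairwise (Function.onFun Disjoint A) := by
    intro t t' htt'
    refine Set.disjoint_left.2 fun ω h1 h2 => htt' ?_
    exact IsLeast.unique h1 h2
  -- The start at time `t` is decided by the swaps before `t / 2`, and the window uses only swaps
  -- from `s ≥ (t + 1) / 2` on.
  have hind : ∀ t s, (t + 1) / 2 ≤ s → μ (A t ∩ B s) ≤ μ (A t) * ε := by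
    intro t s hs
    have hdisj : Disjoint (Finset.range (t / 2)) (Finset.Ico s (s + (m + j))) := by
      rw [Finset.disjoint_left]
      intro x h1 h2
      rw [Finset.mem_range] at h1
      rw [Finset.mem_Ico] at h2
      omega
    have h1 := (indepFun_comp_of_dependsOn hE.indep hm hdisj
      (dependsOn_startsIteration hT M₀ H₀ a t)
      (dependsOn_goodWindow m j h s)).measure_inter_preimage_eq_mul {True} {False}
      MeasurableSet.of_discrete MeasurableSet.of_discrete
    have hA' : (fun ω => StartsIteration (run hT 2 M₀ H₀ fun i => E i ω) (a + 1) t) ⁻¹' {True} =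
        A t := by ext; simp [hA]
    have hB' : (fun ω => GoodWindow m j h s fun i => E i ω) ⁻¹' {False} = B s := by
      ext; simp [hB]
    rw [hA', hB'] at h1
    rw [h1]
    gcongr
    exact hε s
  calc _ ≤ μ (⋃ t, ⋃ q ∈ Finset.range Q, A t ∩ B ((t + 1) / 2 + q)) := by
        refine measure_mono ?_
        rintro ω ⟨t, ht, s, hs1, hs2, hs⟩
        simp only [Set.mem_iUnion]
        refine ⟨t, s - (t + 1) / 2, by simp; omega, ht, ?_⟩
        rwa [Nat.add_sub_cancel' hs1]
    _ ≤ ∑' t, μ (⋃ q ∈ Finset.range Q, A t ∩ B ((t + 1) / 2 + q)) := measure_iUnion_le _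
    _ ≤ ∑' t, μ (A t) * (Q * ε) := by
        refine ENNReal.tsum_le_tsum fun t => (measure_biUnion_finset_le _ _).trans ?_
        refine (Finset.sum_le_sum fun q _ => hind t _ (Nat.le_add_right _ q)).trans ?_
        rw [Finset.sum_const, Finset.card_range, nsmul_eq_mul]
        exact le_of_eq (by ring)
    -- An iteration has only one starting time, so summing over all `t` costs no factor beyond `Q`.
    _ = μ (⋃ t, A t) * (Q * ε) := by
        rw [ENNReal.tsum_mul_right, measure_iUnion hAdisj hAmeas]
    _ ≤ 1 * (Q * ε) := by
        gcongr
        exact prob_le_one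
    _ = Q * ε := one_mul _

lemma le_measureReal_of_forall_notMem {A B : Set Ω} {ε : ℝ} (hε : 0 ≤ ε)
    (hB : μ B ≤ ENNReal.ofReal ε) (h : ∀ ω ∉ B, ω ∈ A) : 1 - ε ≤ μ.real A := by
  have h1 : μ.real Set.univ ≤ μ.real A + μ.real B :=
    (measureReal_mono (fun ω _ => by
      by_cases hω : ω ∈ B
      exacts [Or.inr hω, Or.inl (h ω hω)])).trans (measureReal_union_le A B)
  have h2 : μ.real B ≤ ε := ENNReal.toReal_le_of_le_ofReal hε hB
  rw [probReal_univ] at h1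
  linarith

end Probability

/-! ### Logarithmic number of iterations against exponential decay -/

section Numerics

lemma isBigO_ceil_log_div (b : ℝ) :
    (fun n : ℕ => (⌈Real.log n / b⌉₊ : ℝ)) =O[atTop] fun n : ℕ => Real.log n := by
  refine IsBigO.of_bound (|b⁻¹| + 1) ?_
  filter_upwards [eventually_ge_atTop 3] with n hn
  have h1 : 1 ≤ Real.log n := by
    rw [Real.le_log_iff_exp_le (by positivity)]
    have h3 : (3 : ℝ) ≤ n := by exact_mod_cast hn
    linarith [Real.exp_one_lt_d9]
  rw [Real.norm_of_nonneg (by positivity), Real.norm_of_nonneg (by linarith)]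
  have h2 : Real.log n / b ≤ |b⁻¹| * Real.log n := by
    rw [div_eq_inv_mul]
    gcongr
    exact le_abs_self _
  calc (⌈Real.log n / b⌉₊ : ℝ) ≤ ⌈|b⁻¹| * Real.log n⌉₊ := by gcongr
    _ ≤ |b⁻¹| * Real.log n + 1 := (Nat.ceil_lt_add_one (by positivity)).le
    _ ≤ _ := by linarith

lemma eventually_ceil_log_mul_le_exp {b γ : ℝ} (hb : 0 < b) (hγ : 0 < γ) :
    ∀ᶠ n : ℕ in atTop, (⌈Real.log n / b⌉₊ : ℝ) * (n * (2 * n + 1)) * 2 ≤ Real.exp (γ * n) := by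
  have ho := (isLittleO_pow_exp_pos_mul_atTop 3 hγ).comp_tendsto tendsto_natCast_atTop_atTop
  have hB : (0 : ℝ) < 6 * (1 / b + 1) := by positivity
  filter_upwards [ho.bound (inv_pos.2 hB), eventually_ge_atTop 1] with n hn hn1
  have hn1 : (1 : ℝ) ≤ n := by exact_mod_cast hn1
  simp only [Function.comp_apply, norm_pow, Real.norm_eq_abs,
    Real.abs_exp, Nat.abs_cast] at hn
  rw [← div_eq_inv_mul, le_div_iff₀ hB] at hn
  have hlog : Real.log n ≤ n := (Real.log_le_sub_one_of_pos (by linarith)).trans (by linarith)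
  have hlog0 : 0 ≤ Real.log n := Real.log_nonneg hn1
  have hz : (⌈Real.log n / b⌉₊ : ℝ) ≤ (1 / b + 1) * n := by
    calc (⌈Real.log n / b⌉₊ : ℝ) ≤ Real.log n / b + 1 :=
          (Nat.ceil_lt_add_one (by positivity)).le
      _ ≤ n / b + n := by gcongr
      _ = _ := by ring
  calc (⌈Real.log n / b⌉₊ : ℝ) * (n * (2 * n + 1)) * 2
      ≤ ((1 / b + 1) * n) * (n * (2 * n + n)) * 2 := by gcongr
    _ = (n : ℝ) ^ 3 * (6 * (1 / b + 1)) := by ring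
    _ ≤ _ := hn

lemma le_pow_ceil_log_div {x : ℝ} (hx : 1 < x) {n : ℕ} (hn : 0 < n) :
    (n : ℝ) ≤ x ^ ⌈Real.log n / Real.log x⌉₊ := by
  have hlog : 0 < Real.log x := Real.log_pos hx
  have hn' : (0 : ℝ) < n := by exact_mod_cast hn
  rw [← Real.log_le_log_iff hn' (by positivity), Real.log_pow, ← div_le_iff₀ hlog]
  exact Nat.le_ceil _

end Numerics

end LabelTracking

/-! ### Choice of constants and conclusion -/

theorem mainTheorem2 (k : ℕ) :
    ∃ (z : ℕ → ℕ) (C γ : ℝ), 0 < C ∧ 0 < γ ∧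
      (fun n : ℕ => (z n : ℝ)) =O[atTop] (fun n : ℕ => Real.log n) ∧
      ∀ (n : ℕ) [NeZero n] (V : Type*) [Fintype V] [DecidableEq V]
        (T : SimpleGraph V) [DecidableRel T.Adj] (hT : T.IsTree) (_ : T.maxDegree ≤ k)
        (M₀ : Fin n ≃ V) (H₀ : Fin n → V)
        (Ω : Type*) [MeasurableSpace Ω] (μ : Measure Ω) [IsProbabilityMeasure μ]
        (E : ℕ → Ω → T.edgeSet) (_ : LabelTracking.IsUniformEvolver μ E)
        (j : ℕ) (_ : z n < j),
        1 - Real.exp (-γ * n) ≤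
          μ.real {ω | ∃ t,
            LabelTracking.StartsIteration
              (LabelTracking.run hT 2 M₀ H₀ (fun i => E i ω)) j t ∧
            ((LabelTracking.run hT 2 M₀ H₀ (fun i => E i ω) t).distance T : ℝ) ≤ C * n} := by
  -- `κ` bounds the number of edges meeting an edge and is positive even for `k = 0`. `K` makes `r`,
  -- about `n / K`, small enough for few clashes, and `c` satisfies `8 * κ * r + 2 * r ≤ 10 * κ * r
  -- = 2 * c * ρ`.
  obtain ⟨κ, hκdef⟩ : ∃ κ, κ = 2 * k + 1 := ⟨_, rfl⟩
  obtain ⟨K, hKdef⟩ : ∃ K, K = 1000 * κ ^ 3 := ⟨_, rfl⟩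
  obtain ⟨c, hcdef⟩ : ∃ c, c = 40 * κ * K := ⟨_, rfl⟩
  have hκ : 0 < κ := by omega
  have hK : 0 < K := by rw [hKdef]; positivity
  have hc : 0 < c := by rw [hcdef]; positivity
  have hKR : (0 : ℝ) < K := by exact_mod_cast hK
  have hcR : (0 : ℝ) < c := by exact_mod_cast hc
  have hx : (1 : ℝ) < 1 + 1 / c := by
    have : (0 : ℝ) < 1 / c := by positivity
    linarith
  set b := Real.log (1 + 1 / c) with hb
  have hb0 : 0 < b := Real.log_pos hx
  -- Below, `ρ ≥ n / (16 * K ^ 2) = 2 * γ * n`: half of this exponent absorbs the polynomial factor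
  -- of the union bound.
  set γ : ℝ := 1 / (32 * K ^ 2) with hγ
  have hγ0 : 0 < γ := by positivity
  obtain ⟨n₀, hn₀⟩ := eventually_atTop.1
    ((LabelTracking.eventually_ceil_log_mul_le_exp hb0 hγ0).and (eventually_ge_atTop (8 * K ^ 2)))
  refine ⟨fun n => ⌈Real.log n / b⌉₊, n₀ + (1 + 12 * c), γ, by positivity, hγ0,
    LabelTracking.isBigO_ceil_log_div b, ?_⟩
  intro n _ V _ _ T _ hT hk M₀ H₀ Ω _ μ _ E hE j hj
  have hn : 0 < n := Nat.pos_of_ne_zero (NeZero.ne n)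
  set z := ⌈Real.log n / b⌉₊ with hz
  have hj : z < j := hj
  obtain ⟨a, rfl⟩ : ∃ a, j = a + z + 1 := ⟨j - z - 1, by omega⟩
  -- For small `n` the bound holds surely, because `D ≤ n * n ≤ n₀ * n`; this is why `n₀` enters
  -- `C`.
  rcases lt_or_ge n n₀ with hsmall | hlarge
  · refine LabelTracking.le_measureReal_of_forall_notMem (B := ∅) (Real.exp_pos _).le (by simp)
      fun ω _ => ?_
    obtain ⟨t, ht⟩ := LabelTracking.exists_startsIteration hT M₀ H₀ (fun i => E i ω) (a + z)
    refine ⟨t, ht, ?_⟩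
    have h1 : ((LabelTracking.run hT 2 M₀ H₀ (fun i => E i ω) t).distance T : ℝ) ≤ n * n := by
      exact_mod_cast LabelTracking.distance_run_le_sq hT M₀ H₀ _ t
    have h2 : (n : ℝ) ≤ n₀ := by exact_mod_cast hsmall.le
    refine h1.trans ?_
    gcongr
    have : (0 : ℝ) ≤ 1 + 12 * c := by positivity
    linarith
  obtain ⟨hexp, hnK⟩ := hn₀ n hlarge
  obtain ⟨ρ, hρdef⟩ : ∃ ρ, ρ = n / (8 * K ^ 2) := ⟨_, rfl⟩
  obtain ⟨r, hrdef⟩ : ∃ r, r = 8 * K * ρ := ⟨_, rfl⟩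
  have hρ : 0 < ρ := hρdef ▸ Nat.div_pos hnK (by positivity)
  have hρn : ρ ≤ n := hρdef ▸ Nat.div_le_self _ _
  have hlow : 8 * K ^ 2 * ρ ≤ n := hρdef ▸ Nat.mul_div_le _ _
  have hupp : n < 8 * K ^ 2 * (ρ + 1) := hρdef ▸ Nat.lt_mul_div_succ _ (by positivity)
  have hupp' : n ≤ 16 * K ^ 2 * ρ := by
    have : 8 * K ^ 2 * 1 ≤ 8 * K ^ 2 * ρ := Nat.mul_le_mul_left _ hρ
    nlinarith
  have hcardE : Fintype.card T.edgeSet + 1 = n := by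
    have h := hT.card_edgeFinset
    rw [SimpleGraph.edgeFinset_card] at h
    rw [h, Fintype.card_congr M₀.symm, Fintype.card_fin]
  have hr1 : Fintype.card T.edgeSet ≤ 2 * K * r := by
    have : 2 * K * r = 16 * K ^ 2 * ρ := by rw [hrdef]; ring
    omega
  -- A tree has only `n - 1` edges; the slack between 960 and 1000 absorbs the missing one.
  have hr2 : 960 * κ ^ 3 * r ≤ Fintype.card T.edgeSet := by
    have h1 : 960 * κ ^ 3 * r + 40 * κ ^ 3 * r = 8 * K ^ 2 * ρ := by
      calc _ = (1000 * κ ^ 3) * r := by ring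
        _ = _ := by rw [← hKdef, hrdef]; ring
    have h2 : 0 < 40 * κ ^ 3 * r := by rw [hrdef]; positivity
    omega
  have hw0 : 0 < 8 * κ * r + 2 * r := by rw [hrdef]; positivity
  have hw : 8 * κ * r + 2 * r ≤ 2 * c * ρ := by
    have h1 : 2 * r ≤ 2 * κ * r := Nat.mul_le_mul_right _ (by omega)
    have h2 : 2 * c * ρ = 8 * κ * r + 2 * κ * r := by rw [hcdef, hrdef]; ring
    omega
  have hbad := LabelTracking.measure_exists_not_goodWindow_le hT M₀ H₀ hE
    (LabelTracking.measure_not_goodWindow_le hE (by omega : 2 * T.maxDegree ≤ κ) hκ hK hrdef hr1 hr2)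
    a (z * (n * (2 * n + 1)))
  refine LabelTracking.le_measureReal_of_forall_notMem (Real.exp_pos _).le (hbad.trans ?_)
    fun ω hω => ?_
  · rw [← ENNReal.ofReal_natCast, ← ENNReal.ofReal_mul (by positivity)]
    refine ENNReal.ofReal_le_ofReal ?_
    have hρR : 2 * γ * n ≤ ρ := by
      have h1 : (n : ℝ) ≤ 16 * K ^ 2 * ρ := by exact_mod_cast hupp'
      have h2 : 2 * γ * n = n / (16 * K ^ 2) := by
        rw [hγ]
        field_simp
        norm_num
      rw [h2, div_le_iff₀ (by positivity)]
      linarith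
    calc ((z * (n * (2 * n + 1)) : ℕ) : ℝ) * (2 * Real.exp (-ρ))
        = (z : ℝ) * (n * (2 * n + 1)) * 2 * Real.exp (-ρ) := by push_cast; ring
      _ ≤ Real.exp (γ * n) * Real.exp (-(2 * γ * n)) := by gcongr
      _ = Real.exp (-γ * n) := by
        rw [← Real.exp_add]
        congr 1
        ring
  · obtain ⟨t, ht⟩ := LabelTracking.exists_startsIteration hT M₀ H₀ (fun i => E i ω) a
    obtain ⟨t', -, -, h1, h2⟩ := LabelTracking.exists_startsIteration_distance_le hT M₀ H₀
      (fun i => E i ω) hρ hρn hc hw0 hw ht z (by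
        intro s hs1 hs2
        by_contra hs
        exact hω ⟨t, ht, s, hs1, hs2, hs⟩)
    refine ⟨t', h1, h2.trans ?_⟩
    have hpow := LabelTracking.le_pow_ceil_log_div hx hn
    -- The choice of `z` gives `n ≤ (1 + 1 / c) ^ z`, which removes one factor `n` from the trivial
    -- bound.
    have h3 : (n : ℝ) * n / (1 + 1 / c) ^ z ≤ n := by
      rw [div_le_iff₀ (by positivity)]
      gcongr
    have h4 : (0 : ℝ) ≤ n₀ * n := by positivity
    nlinarith
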